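/- Let $\mathbf u=(u_1,u_2)^T:\mathbb R^2\to\mathbb C^2$ be a $C^2$ solution of the focusing complex coupled short pulse equation $\mathbf u_{xt}=\mathbf u+\frac12(\|\mathbf u\|^2\mathbf u_x)_x$ such that, for every $t$, $\mathbf u(\cdot,t)$ and $\mathbf u_x(\cdot,t)$ tend to $0$ as $x\to\pm\infty$ and $\mathbf u_x(\cdot,t)\in L^1(\mathbb R)$. Put $$U=\begin{pmatrix}-iu_1&-iu_2\\ iu_2^*&-iu_1^*\end{pmatrix},\qquad V=U^\dagger,\qquad X=\begin{pmatrix}-ikI_2&kU_x\\-kV_x&ikI_2\end{pmatrix},$$ $$T=\begin{pmatrix}\frac{i}{4k}I_2-\frac i2kUV&-\frac i2U+\frac12kUVU_x\\-\frac i2V-\frac12kVUV_x&-\frac{i}{4k}I_2+\frac i2kVU\end{pmatrix},\qquad k\neq0,$$ and $\theta(x,t,k)=k\,\xi(x,t)-\frac{t}{4k}$ with $\xi(x,t)=x-\int_x^\infty\big(\sqrt{1+\|\mathbf u_y\|^2}-1\big)\,dy$. Let $\Phi_\pm=(\Phi_{\pm,1},\Phi_{\pm,2})$ be the Jost eigenfunctions,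 given in $4\times2$ column groups: simultaneous solutions of $\Phi_x=X\Phi$, $\Phi_t=T\Phi$ such that, for every $t$, $e^{i\theta}\Phi_{\pm,1}\to\binom{I_2}{0}$ and $e^{-i\theta}\Phi_{\pm,2}\to\binom{0}{I_2}$ as $x\to\pm\infty$, where $\Phi_{-,1},\Phi_{+,2}$ are taken for $\operatorname{Im}k\ge0$, $k\ne0$, and $\Phi_{+,1},\Phi_{-,2}$ for $\operatorname{Im}k\le0$, $k\neq0$. For real $k\ne0$ let $S(k)=\begin{pmatrix}a(k)&\bar b(k)\\ b(k)&\bar a(k)\end{pmatrix}$ be the scattering matrix, $\Phi_-(x,t,k)=\Phi_+(x,t,k)S(k)$ for all $x,t$. Extend $a$ (respectively $\bar a$) to a function continuous on $\{\operatorname{Im}k\ge0,\ k\ne0\}$ and analytic in $\mathbb C^+=\{\operatorname{Im}k>0\}$ (respectively continuous on $\{\operatorname{Im}k\le0,\ k\neq0\}$ and analytic in $\mathbb C^-=\{\operatorname{Im}k<0\}$). Put $$P=(\Phi_{-,1},\Phi_{+,2}),\qquad \bar P=(\Phi_{+,1},\Phi_{-,2}),\qquad A(x,t,k)=\bar P^\dagger(x,t,k^*)\,P(x,t,k).$$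 Then $S(k)$ and the extensions of $a$ and $\bar a$ exist. Moreover, let $k_n\in\mathbb C^+$ with $\det a(k_n)=0$. Then $\det a(-k_n^*)=\det\bar a(k_n^*)=\det\bar a(-k_n)=0$, and the following hold. 1. For all $x,t\in\mathbb R$: $\operatorname{rank}P(x,t,k_n)=\operatorname{rank}\bar P(x,t,k_n^*)=2$ if and only if $a(k_n)=\bar a(k_n^*)=0$, and if and only if $\operatorname{rank}A(x,t,k_n)=0$. Each of the single conditions $\operatorname{rank}P(x,t,k_n)=2$ and $\operatorname{rank}\bar P(x,t,k_n^*)=2$ is also equivalent to these. 2. The same equivalences hold with $k_n$, $k_n^*$ replaced by $-k_n^*$, $-k_n$ respectively. 3. $\operatorname{rank}a(k_n)=\operatorname{rank}a(-k_n^*)=\operatorname{rank}\bar a(k_n^*)=\operatorname{rank}\bar a(-k_n)$. -/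

import Mathlib

noncomputable section

namespace CCSPE

open Matrix Filter Topology

/-- A two-component complex field `u = (u₁, u₂)ᵀ`, as a function of `x` and then of `t`. -/
abbrev VField := ℝ → ℝ → EuclideanSpace ℂ (Fin 2)

/-- The partial derivative `u_x`. -/
def ux (u : VField) (x t : ℝ) : EuclideanSpace ℂ (Fin 2) := deriv (fun y => u y t) x

/-- `u` is a classical (`C²`) solution of the focusing complex coupled short pulse equation
`u_xt = u + (1/2) (‖u‖² u_x)_x`. -/
structure IsSolution (u : VField) : Prop where
  contDiff : ContDiff ℝ 2 (fun p : ℝ × ℝ => u p.1 p.2)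
  pde : ∀ x t : ℝ, deriv (fun s => ux u x s) t =
    u x t + (1 / 2 : ℝ) • deriv (fun y => (‖u y t‖ ^ 2 : ℝ) • ux u y t) x

/-- Decay as `|x| → ∞`, for each `t`: `u` and `u_x` tend to `0`, and `u_x` is integrable. -/
structure Decays (u : VField) : Prop where
  tendsto_atBot : ∀ t, Tendsto (fun x => u x t) atBot (𝓝 0)
  tendsto_atTop : ∀ t, Tendsto (fun x => u x t) atTop (𝓝 0)
  ux_tendsto_atBot : ∀ t, Tendsto (fun x => ux u x t) atBot (𝓝 0)
  ux_tendsto_atTop : ∀ t, Tendsto (fun x => ux u x t) atTop (𝓝 0)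
  ux_integrable : ∀ t, MeasureTheory.Integrable (fun x => ux u x t)

/-- The matrix `U` built from a vector `(v₁, v₂)`. It is real-linear in the vector, so that
`U = potential (u x t)` has `x`-derivative `U_x = potential (ux u x t)`. -/
def potential (v : EuclideanSpace ℂ (Fin 2)) : Matrix (Fin 2) (Fin 2) ℂ :=
  !![-Complex.I * v 0, -Complex.I * v 1; Complex.I * star (v 1), -Complex.I * star (v 0)]

/-- `4 × 4` matrices in `2 × 2` blocks. -/
abbrev Mat4 := Matrix (Fin 2 ⊕ Fin 2) (Fin 2 ⊕ Fin 2) ℂ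

/-- `4 × 2` matrices (an upper and a lower `2 × 2` block). -/
abbrev Mat42 := Matrix (Fin 2 ⊕ Fin 2) (Fin 2) ℂ

/-- `2 × 2` matrices. -/
abbrev Mat2 := Matrix (Fin 2) (Fin 2) ℂ

/-- The Lax matrix `X` of the scattering problem `Φ_x = X Φ`. -/
def laxX (u : VField) (x t : ℝ) (k : ℂ) : Mat4 :=
  let Ux := potential (ux u x t)
  fromBlocks (-(Complex.I * k) • (1 : Mat2)) (k • Ux) (-k • Uxᴴ) ((Complex.I * k) • (1 : Mat2))

/-- The Lax matrix `T` of the time evolution `Φ_t = T Φ` (with `V = Uᴴ`). -/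
def laxT (u : VField) (x t : ℝ) (k : ℂ) : Mat4 :=
  let U := potential (u x t)
  let Ux := potential (ux u x t)
  fromBlocks
    ((Complex.I / (4 * k)) • (1 : Mat2) - (Complex.I / 2 * k) • (U * Uᴴ))
    (-(Complex.I / 2) • U + (k / 2) • (U * Uᴴ * Ux))
    (-(Complex.I / 2) • Uᴴ - (k / 2) • (Uᴴ * U * Uxᴴ))
    (-(Complex.I / (4 * k)) • (1 : Mat2) + (Complex.I / 2 * k) • (Uᴴ * U))

/-- `ξ(x,t) = x - ∫_x^∞ (√(1 + ‖u_y‖²) - 1) dy`. -/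
def xi (u : VField) (x t : ℝ) : ℝ :=
  x - ∫ y in Set.Ioi x, (Real.sqrt (1 + ‖ux u y t‖ ^ 2) - 1)

/-- The phase `θ(x,t,k) = k ξ(x,t) - t / (4k)`. -/
def theta (u : VField) (x t : ℝ) (k : ℂ) : ℂ := k * (xi u x t : ℂ) - (t : ℂ) / (4 * k)

/-- `Ψ` solves both equations `Ψ_x = X Ψ` and `Ψ_t = T Ψ` of the Lax pair at the spectral
parameter `k`. -/
def IsLaxSolution (u : VField) (k : ℂ) (Ψ : ℝ → ℝ → Mat42) : Prop :=
  ∀ (x t : ℝ) (i : Fin 2 ⊕ Fin 2) (j : Fin 2),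
    HasDerivAt (fun y => Ψ y t i j) ((laxX u x t k * Ψ x t) i j) x ∧
    HasDerivAt (fun s => Ψ x s i j) ((laxT u x t k * Ψ x t) i j) t

/-- The Jost eigenfunctions of `u`: the simultaneous solutions `Φ₋ = (Φ₋₁, Φ₋₂)`,
`Φ₊ = (Φ₊₁, Φ₊₂)` of the Lax pair with `Φ_± ~ e^{-iθΣ₃}`, `Σ₃ = diag(I₂, -I₂)`, as `x → ±∞`.
The column groups `Φ₋₁`, `Φ₊₂` are defined for `Im k ≥ 0` and `Φ₊₁`, `Φ₋₂` for `Im k ≤ 0`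
(`k ≠ 0` throughout, where the Lax pair makes sense). -/
structure JostEigenfunctions (u : VField) where
  minus₁ : ℝ → ℝ → ℂ → Mat42
  minus₂ : ℝ → ℝ → ℂ → Mat42
  plus₁ : ℝ → ℝ → ℂ → Mat42
  plus₂ : ℝ → ℝ → ℂ → Mat42
  minus₁_lax : ∀ k : ℂ, 0 ≤ k.im → k ≠ 0 → IsLaxSolution u k (fun x t => minus₁ x t k)
  plus₂_lax : ∀ k : ℂ, 0 ≤ k.im → k ≠ 0 → IsLaxSolution u k (fun x t => plus₂ x t k)
  plus₁_lax : ∀ k : ℂ, k.im ≤ 0 → k ≠ 0 → IsLaxSolution u k (fun x t => plus₁ x t k)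
  minus₂_lax : ∀ k : ℂ, k.im ≤ 0 → k ≠ 0 → IsLaxSolution u k (fun x t => minus₂ x t k)
  minus₁_tendsto : ∀ k : ℂ, 0 ≤ k.im → k ≠ 0 → ∀ t : ℝ,
    Tendsto (fun x => Complex.exp (Complex.I * theta u x t k) • minus₁ x t k) atBot
      (𝓝 (fromRows (1 : Mat2) (0 : Mat2)))
  plus₂_tendsto : ∀ k : ℂ, 0 ≤ k.im → k ≠ 0 → ∀ t : ℝ,
    Tendsto (fun x => Complex.exp (-(Complex.I * theta u x t k)) • plus₂ x t k) atTop
      (𝓝 (fromRows (0 : Mat2) (1 : Mat2)))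
  plus₁_tendsto : ∀ k : ℂ, k.im ≤ 0 → k ≠ 0 → ∀ t : ℝ,
    Tendsto (fun x => Complex.exp (Complex.I * theta u x t k) • plus₁ x t k) atTop
      (𝓝 (fromRows (1 : Mat2) (0 : Mat2)))
  minus₂_tendsto : ∀ k : ℂ, k.im ≤ 0 → k ≠ 0 → ∀ t : ℝ,
    Tendsto (fun x => Complex.exp (-(Complex.I * theta u x t k)) • minus₂ x t k) atBot
      (𝓝 (fromRows (0 : Mat2) (1 : Mat2)))

/-- `F` is the extension of `f` (given on the real axis without `0`) that is analytic in the open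
upper half plane and continuous up to the real axis without `0`. -/
structure IsUpperExtension (f : ℝ → Mat2) (F : ℂ → Mat2) : Prop where
  analytic : ∀ i j, DifferentiableOn ℂ (fun k => F k i j) {k : ℂ | 0 < k.im}
  continuousOn : ContinuousOn F {k : ℂ | 0 ≤ k.im ∧ k ≠ 0}
  boundary : ∀ k : ℝ, k ≠ 0 → F (k : ℂ) = f k

/-- The same for the lower half plane. -/
structure IsLowerExtension (f : ℝ → Mat2) (F : ℂ → Mat2) : Prop where
  analytic : ∀ i j, DifferentiableOn ℂ (fun k => F k i j) {k : ℂ | k.im < 0}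
  continuousOn : ContinuousOn F {k : ℂ | k.im ≤ 0 ∧ k ≠ 0}
  boundary : ∀ k : ℝ, k ≠ 0 → F (k : ℂ) = f k

namespace JostEigenfunctions

variable {u : VField} (Φ : JostEigenfunctions u)

/-- The `4 × 4` matrix `Φ₋(x,t,k)` for real `k ≠ 0`. -/
def minus (x t k : ℝ) : Mat4 := fromCols (Φ.minus₁ x t (k : ℂ)) (Φ.minus₂ x t (k : ℂ))

/-- The `4 × 4` matrix `Φ₊(x,t,k)` for real `k ≠ 0`. -/
def plus (x t k : ℝ) : Mat4 := fromCols (Φ.plus₁ x t (k : ℂ)) (Φ.plus₂ x t (k : ℂ))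

/-- `S` is the scattering matrix: `Φ₋(x,t,k) = Φ₊(x,t,k) S(k)` for real `k ≠ 0` and all `x, t`. -/
def IsScatteringMatrix (S : ℝ → Mat4) : Prop :=
  ∀ k : ℝ, k ≠ 0 → ∀ x t : ℝ, Φ.minus x t k = Φ.plus x t k * S k

/-- The scattering matrix `S(k)`, `k` real. -/
def scattering : ℝ → Mat4 := Classical.epsilon Φ.IsScatteringMatrix

/-- `a(k)`: the upper left block of the scattering matrix, extended to the upper half plane. -/
def a : ℂ → Mat2 := Classical.epsilon (IsUpperExtension fun k => (Φ.scattering k).toBlocks₁₁)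

/-- `ā(k)`: the lower right block of the scattering matrix, extended to the lower half plane. -/
def abar : ℂ → Mat2 := Classical.epsilon (IsLowerExtension fun k => (Φ.scattering k).toBlocks₂₂)

/-- `P = (Φ₋₁, Φ₊₂)`. -/
def P (x t : ℝ) (k : ℂ) : Mat4 := fromCols (Φ.minus₁ x t k) (Φ.plus₂ x t k)

/-- `P̄ = (Φ₊₁, Φ₋₂)`. -/
def Pbar (x t : ℝ) (k : ℂ) : Mat4 := fromCols (Φ.plus₁ x t k) (Φ.minus₂ x t k)

/-- `A(k) = P̄†(x,t,k*) P(x,t,k)`. -/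
def A (x t : ℝ) (k : ℂ) : Mat4 := (Φ.Pbar x t (star k))ᴴ * Φ.P x t k

end JostEigenfunctions

end CCSPE

end

/-! The Lax matrix is `X = k X₁` with `X₁` skew-adjoint and `X₁² = -(1 + ‖u_x‖²)`, and `ξ` is a
primitive of `r = √(1 + ‖u_x‖²) = ‖X₁‖`. Hence for `Im k ≥ 0` the norm of `e^{ikξ} ψ` is
nonincreasing in `x` along every solution of `ψ_x = X ψ` (`antitone_norm_gauge`). This energy
estimate replaces the usual Volterra equations: it gives uniqueness of the Jost solutions,
independence of their columns, and, through approximation by solutions entire in `k`, their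
continuity and analyticity in `k`. A reflection in `x` and a sign change of `k` reduce the four
column groups to one case.

Since `X(k*)† = -X(k)` and `T(k*)† = -T(k)`, the products `Ψ₁†(k*) Ψ₂(k)` of Lax solutions are
constant in `x` and `t`. Evaluated on the Jost solutions they give `a(k) = Φ₊₁†(k*) Φ₋₁(k)` and
`ā(k) = Φ₊₂†(k*) Φ₋₂(k)`, together with the orthogonality relations `Φ₊₁†(k*) Φ₊₂(k) = 0` and
`Φ₋₂†(k*) Φ₋₁(k) = 0` in the upper half plane.

Orthogonality and injectivity identify the range of `Φ₊₂(k)` with the kernel of `Φ₊₁†(k*)`, so `rank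
P = 2 + rank a(k)` (`rank_P_eq`). Eliminating the other column group gives `rank P = 2 + rank
ā(k*)`, and the same argument gives `rank P̄(k*) = 2 + rank a(k)`. The quaternionic form of `U`
yields a symmetry `k ↦ -k*`, whence `rank a(-k*) = rank a(k)`. Also `A = diag(a(k), ā(k*)†)`. Every
claim about `k_n` is then arithmetic with the single number `rank a(k_n)`. -/

noncomputable section

namespace CCSPE

open Filter Topology

/-! ### Energy estimates for skew-adjoint linear systems. -/

section LinearODE

variable {E : Type*} [NormedAddCommGroup E] [InnerProductSpace ℂ E]

/-- A continuous family `B` of skew-adjoint operators with `‖B x‖ ≤ r x`, and a primitive `ρ`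
of `r`. -/
structure SkewSystem (B : ℝ → E →L[ℂ] E) (r ρ : ℝ → ℝ) : Prop where
  continuous : Continuous B
  skew : ∀ x v w, inner ℂ (B x v) w = -inner ℂ v (B x w)
  bound : ∀ x v, ‖B x v‖ ≤ r x * ‖v‖
  phase : ∀ x, HasDerivAt ρ (r x) x

/-- `ψ` solves `ψ' = k B ψ`. -/
def SolvesODE (B : ℝ → E →L[ℂ] E) (k : ℂ) (ψ : ℝ → E) : Prop :=
  ∀ x, HasDerivAt ψ (k • B x (ψ x)) x

/-- The gauge transform `e^{ikρ} ψ`. -/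
def gauge (ρ : ℝ → ℝ) (k : ℂ) (ψ : ℝ → E) (x : ℝ) : E :=
  Complex.exp (Complex.I * (k * ρ x)) • ψ x

theorem SolvesODE.sub {B : ℝ → E →L[ℂ] E} {k : ℂ} {ψ φ : ℝ → E}
    (hψ : SolvesODE B k ψ) (hφ : SolvesODE B k φ) : SolvesODE B k (fun x => ψ x - φ x) := by
  intro x
  exact ((hψ x).sub (hφ x)).congr_deriv (by simp [smul_sub])

theorem SolvesODE.const_smul {B : ℝ → E →L[ℂ] E} {k : ℂ} {ψ : ℝ → E}
    (hψ : SolvesODE B k ψ) (c : ℂ) : SolvesODE B k (fun x => c • ψ x) := by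
  intro x
  exact ((hψ x).const_smul c).congr_deriv (by simp [smul_comm c k])

theorem gauge_sub (ρ : ℝ → ℝ) (k : ℂ) (ψ φ : ℝ → E) (x : ℝ) :
    gauge ρ k (fun x => ψ x - φ x) x = gauge ρ k ψ x - gauge ρ k φ x := by
  simp [gauge, smul_sub]

theorem gauge_eq_zero_iff {ρ : ℝ → ℝ} {k : ℂ} {ψ : ℝ → E} {x : ℝ} :
    gauge ρ k ψ x = 0 ↔ ψ x = 0 := by
  simp [gauge]

namespace SkewSystem

variable {B : ℝ → E →L[ℂ] E} {r ρ : ℝ → ℝ}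

/-- Skewness makes `⟨v, B v⟩` purely imaginary, of modulus at most `r ‖v‖²`. So `⟨v, (ir + B) v⟩` is
`i` times a nonnegative number, and multiplying by `k` turns its real part into `-Im k` times that
number. -/
theorem re_inner_nonpos (hS : SkewSystem B r ρ) {k : ℂ} (hk : 0 ≤ k.im) (x : ℝ) (v : E) :
    (inner ℂ v (k • ((Complex.I * r x) • v + B x v))).re ≤ 0 := by
  have h1 : (inner ℂ v (B x v)).re = 0 := by
    have h := congrArg Complex.re (hS.skew x v v)
    rw [← inner_conj_symm] at h
    simp only [Complex.conj_re, Complex.neg_re] at h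
    linarith
  have h2 : |(inner ℂ v (B x v)).im| ≤ r x * ‖v‖ ^ 2 := by
    refine (Complex.abs_im_le_norm _).trans ((norm_inner_le_norm _ _).trans ?_)
    nlinarith [mul_le_mul_of_nonneg_left (hS.bound x v) (norm_nonneg v)]
  rw [inner_smul_right, inner_add_right, inner_smul_right,
    inner_self_eq_norm_sq_to_K]
  have h3 : (((‖v‖ : ℝ) : ℂ) ^ 2) = ((‖v‖ ^ 2 : ℝ) : ℂ) := by push_cast; rfl
  simp only [Complex.coe_algebraMap, h3]
  have h4 : (k * (Complex.I * (r x : ℂ) * ((‖v‖ ^ 2 : ℝ) : ℂ) + inner ℂ v (B x v))).re =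
      -(k.im * (r x * ‖v‖ ^ 2 + (inner ℂ v (B x v)).im)) := by
    rw [Complex.mul_re]
    simp only [Complex.add_re, Complex.add_im, Complex.mul_re, Complex.mul_im, Complex.I_re,
      Complex.I_im, Complex.ofReal_re, Complex.ofReal_im, h1]
    ring
  rw [h4]
  have := (abs_le.1 h2).1
  have : 0 ≤ k.im * (r x * ‖v‖ ^ 2 + (inner ℂ v (B x v)).im) :=
    mul_nonneg hk (by linarith)
  linarith

/-- The energy inequality with a forcing term `f`, whose contribution to `‖v‖²` is absorbed by `γ`.
The case `f = 0` gives monotonicity; a nonzero `f` measures the distance to the limit at `-∞`. -/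
theorem antitone_norm_sq_sub (hS : SkewSystem B r ρ) {k : ℂ} (hk : 0 ≤ k.im) {v f : ℝ → E}
    (hv : ∀ x, HasDerivAt v (k • ((Complex.I * r x) • v x + B x (v x)) + f x) x)
    {γ g : ℝ → ℝ} (hγ : ∀ x, HasDerivAt γ (g x) x) (hf : ∀ x, 2 * (‖v x‖ * ‖f x‖) ≤ g x) :
    Antitone fun x => ‖v x‖ ^ 2 - γ x := by
  let _ : InnerProductSpace ℝ E := InnerProductSpace.complexToReal
  have hd := fun x => (HasDerivAt.norm_sq (hv x)).sub (hγ x)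
  refine antitone_of_deriv_nonpos (fun x => (hd x).differentiableAt) fun x => ?_
  have := (hd x).deriv
  rw [show (fun x => ‖v x‖ ^ 2 - γ x) = (fun x => ‖v x‖ ^ 2) - γ from rfl, this, inner_add_right]
  have h1 : inner ℝ (v x) (k • ((Complex.I * r x) • v x + B x (v x))) ≤ 0 :=
    hS.re_inner_nonpos hk x (v x)
  have h2 := real_inner_le_norm (v x) (f x)
  linarith [hf x]

theorem hasDerivAt_gauge (hS : SkewSystem B r ρ) {k : ℂ} {ψ : ℝ → E} (hψ : SolvesODE B k ψ)
    (x : ℝ) : HasDerivAt (gauge ρ k ψ)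
      (k • ((Complex.I * r x) • gauge ρ k ψ x + B x (gauge ρ k ψ x))) x := by
  have h1 : HasDerivAt (fun x => Complex.exp (Complex.I * (k * ρ x)))
      (Complex.exp (Complex.I * (k * ρ x)) * (Complex.I * (k * r x))) x :=
    ((((hS.phase x).ofReal_comp).const_mul k).const_mul Complex.I).cexp
  refine (h1.smul (hψ x)).congr_deriv ?_
  simp only [gauge, map_smul, smul_add, smul_smul]
  rw [add_comm]
  congr 2 <;> ring

theorem antitone_norm_gauge (hS : SkewSystem B r ρ) {k : ℂ} (hk : 0 ≤ k.im) {ψ : ℝ → E}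
    (hψ : SolvesODE B k ψ) : Antitone fun x => ‖gauge ρ k ψ x‖ := by
  have h := hS.antitone_norm_sq_sub hk (v := gauge ρ k ψ) (f := fun _ => 0)
    (γ := fun _ => 0) (g := fun _ => 0) (fun x => by simpa using hS.hasDerivAt_gauge hψ x)
    (fun x => hasDerivAt_const x 0) (fun x => by simp)
  intro x y hxy
  have := h hxy
  simp only [sub_zero] at this
  exact (sq_le_sq₀ (norm_nonneg _) (norm_nonneg _)).1 this

theorem norm_gauge_le (hS : SkewSystem B r ρ) {k : ℂ} (hk : 0 ≤ k.im) {ψ : ℝ → E}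
    (hψ : SolvesODE B k ψ) {e : E} (hlim : Tendsto (gauge ρ k ψ) atBot (𝓝 e)) (x : ℝ) :
    ‖gauge ρ k ψ x‖ ≤ ‖e‖ :=
  ge_of_tendsto hlim.norm ((eventually_le_atBot x).mono fun _ hy =>
    hS.antitone_norm_gauge hk hψ hy)

/-- The difference of the two solutions has gauge limit `0` at `-∞`, and its gauge norm can only
decrease from there. -/
theorem eq_of_tendsto (hS : SkewSystem B r ρ) {k : ℂ} (hk : 0 ≤ k.im) {ψ φ : ℝ → E}
    (hψ : SolvesODE B k ψ) (hφ : SolvesODE B k φ) {e : E}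
    (hlψ : Tendsto (gauge ρ k ψ) atBot (𝓝 e)) (hlφ : Tendsto (gauge ρ k φ) atBot (𝓝 e))
    (x : ℝ) : ψ x = φ x := by
  have hlim : Tendsto (gauge ρ k fun x => ψ x - φ x) atBot (𝓝 0) := by
    have := hlψ.sub hlφ
    rw [sub_self] at this
    exact this.congr fun x => (gauge_sub ρ k ψ φ x).symm
  have h := hS.norm_gauge_le hk (hψ.sub hφ) hlim x
  rw [norm_zero, norm_le_zero_iff, gauge_eq_zero_iff] at h
  exact sub_eq_zero.1 h

/-- The difference from `e` solves the gauged equation with forcing `k (ir e + B e)`. It is bounded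
by `2 ‖e‖`, so the energy inequality has rate `2 · 2‖e‖ · ‖k‖ g`, which explains the factor `4`. -/
theorem norm_gauge_sub_sq_le (hS : SkewSystem B r ρ) {k : ℂ} (hk : 0 ≤ k.im) {ψ : ℝ → E}
    (hψ : SolvesODE B k ψ) {e : E} (hlim : Tendsto (gauge ρ k ψ) atBot (𝓝 e)) {γ g : ℝ → ℝ}
    (hγ : ∀ x, HasDerivAt γ (g x) x) (hγ0 : Tendsto γ atBot (𝓝 0))
    (he : ∀ x, ‖(Complex.I * r x) • e + B x e‖ ≤ g x) (x : ℝ) :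
    ‖gauge ρ k ψ x - e‖ ^ 2 ≤ 4 * ‖e‖ * ‖k‖ * γ x := by
  have hanti := hS.antitone_norm_sq_sub hk (v := fun x => gauge ρ k ψ x - e)
    (f := fun x => k • ((Complex.I * r x) • e + B x e))
    (γ := fun x => 4 * ‖e‖ * ‖k‖ * γ x) (g := fun x => 4 * ‖e‖ * ‖k‖ * g x)
    (fun x => by
      convert (hS.hasDerivAt_gauge hψ x).sub_const e using 1
      simp only [← smul_add, map_sub, smul_sub]
      congr 1
      abel)
    (fun x => (hγ x).const_mul _)
    (fun x => by
      have h1 : ‖gauge ρ k ψ x - e‖ ≤ 2 * ‖e‖ := by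
        have := hS.norm_gauge_le hk hψ hlim x
        exact (norm_sub_le _ _).trans (by linarith)
      have h2 : ‖k • ((Complex.I * r x) • e + B x e)‖ ≤ ‖k‖ * g x := by
        rw [norm_smul]
        exact mul_le_mul_of_nonneg_left (he x) (norm_nonneg _)
      calc 2 * (‖gauge ρ k ψ x - e‖ * ‖k • ((Complex.I * r x) • e + B x e)‖)
          ≤ 2 * ((2 * ‖e‖) * (‖k‖ * g x)) := by gcongr
        _ = 4 * ‖e‖ * ‖k‖ * g x := by ring)
  have hl : Tendsto (fun x => ‖gauge ρ k ψ x - e‖ ^ 2 - 4 * ‖e‖ * ‖k‖ * γ x) atBot (𝓝 0) := by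
    have := ((hlim.sub_const e).norm.pow 2).sub (hγ0.const_mul (4 * ‖e‖ * ‖k‖))
    simpa using this
  have := ge_of_tendsto hl ((eventually_le_atBot x).mono fun y hy => hanti hy)
  linarith

/-- Reflection `x ↦ σ x` and change of sign `k ↦ τ k` of the spectral parameter. -/
theorem twist (hS : SkewSystem B r ρ) {σ τ : ℝ} (hσ : σ * σ = 1) (hτ : τ * τ = 1) :
    SkewSystem (fun x => ((σ * τ : ℝ) : ℂ) • B (σ * x)) (fun x => r (σ * x))
      (fun x => σ * ρ (σ * x)) where
  continuous := by
    have := hS.continuous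
    fun_prop
  skew x v w := by
    simp [hS.skew, mul_comm]
  bound x v := by
    have h : |σ * τ| = 1 := by
      have : (σ * τ) * (σ * τ) = 1 := by linear_combination τ * τ * hσ + hτ
      rcases mul_self_eq_one_iff.1 this with h | h <;> simp [h]
    simpa [norm_smul, ← abs_mul, h] using hS.bound (σ * x) v
  phase x := by
    have h := ((hS.phase (σ * x)).scomp x ((hasDerivAt_id x).const_mul σ)).const_mul σ
    refine h.congr_deriv ?_
    simp [← mul_assoc, hσ]

/-- After reflection the energy estimate bounds `e^{-ikρ} ψ` at earlier points by its value at `x`.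
A zero at `x` thus forces `ψ = 0` on all of `(-∞, x]`, against the nonzero limit. -/
theorem ne_zero_of_tendsto (hS : SkewSystem B r ρ) {k : ℂ} (hk : 0 ≤ k.im) {ψ : ℝ → E}
    (hψ : SolvesODE B k ψ) {e : E} (he : e ≠ 0) (hlim : Tendsto (gauge ρ k ψ) atBot (𝓝 e))
    (x : ℝ) : ψ x ≠ 0 := by
  intro h0
  have hS' := hS.twist (σ := -1) (τ := 1) (by norm_num) (by norm_num)
  have hψ' : SolvesODE (fun x => (((-1) * 1 : ℝ) : ℂ) • B (-1 * x)) k (fun x => ψ (-1 * x)) := by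
    intro x
    have h := (hψ (-1 * x)).scomp x ((hasDerivAt_id x).const_mul (-1 : ℝ))
    exact h.congr_deriv (by simp)
  have hanti := hS'.antitone_norm_gauge hk hψ'
  have hzero : ∀ y ≤ x, ψ y = 0 := by
    intro y hy
    have h := hanti (show -x ≤ -y by linarith)
    have h' : gauge (fun x => -1 * ρ (-1 * x)) k (fun x => ψ (-1 * x)) (-x) = 0 :=
      gauge_eq_zero_iff.2 (by simpa using h0)
    simp only [h', norm_zero, norm_le_zero_iff, gauge_eq_zero_iff] at h
    simpa using h
  refine he (tendsto_nhds_unique hlim ?_)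
  exact tendsto_const_nhds.congr' ((eventually_le_atBot x).mono fun y hy =>
    (gauge_eq_zero_iff.2 (hzero y hy)).symm)

end SkewSystem

/-! ### Solutions of the initial value problem as power series in `k`. -/

section EntireSolution

variable [CompleteSpace E]

/-- The coefficients of `k^n` in the solution of `ψ' = k B ψ`, `ψ(s) = e`. -/
def picardCoeff (B : ℝ → E →L[ℂ] E) (s : ℝ) (e : E) : ℕ → ℝ → E
  | 0 => fun _ => e
  | n + 1 => fun x => ∫ y in s..x, B y (picardCoeff B s e n y)

omit [CompleteSpace E] in
theorem continuous_picardCoeff {B : ℝ → E →L[ℂ] E} (hB : Continuous B) (s : ℝ) (e : E) (n : ℕ) :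
    Continuous (picardCoeff B s e n) := by
  induction n with
  | zero => exact continuous_const
  | succ n ih =>
    exact intervalIntegral.continuous_primitive
      (fun a b => (hB.clm_apply ih).intervalIntegrable a b) s

theorem hasDerivAt_picardCoeff {B : ℝ → E →L[ℂ] E} (hB : Continuous B) (s : ℝ) (e : E) (n : ℕ)
    (x : ℝ) : HasDerivAt (picardCoeff B s e (n + 1)) (B x (picardCoeff B s e n x)) x :=
  ((hB.clm_apply (continuous_picardCoeff hB s e n)).integral_hasStrictDerivAt s x).hasDerivAt

omit [CompleteSpace E] in
theorem norm_picardCoeff_le {B : ℝ → E →L[ℂ] E} (hB : Continuous B) {s L M : ℝ} (e : E)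
    (hM : ∀ x ∈ Metric.closedBall s L, ‖B x‖ ≤ M) (n : ℕ) (x : ℝ)
    (hx : x ∈ Metric.closedBall s L) :
    ‖picardCoeff B s e n x‖ ≤ ‖e‖ * (M ^ n * |x - s| ^ n / n.factorial) := by
  have hM0 : 0 ≤ M := (norm_nonneg _).trans (hM x hx)
  induction n generalizing x with
  | zero => simp [picardCoeff]
  | succ n ih =>
    have hsub : ∀ y ∈ Set.uIoc s x, y ∈ Metric.closedBall s L := fun y hy => by
      rw [Metric.mem_closedBall, Real.dist_eq] at hx ⊢
      exact (Set.abs_sub_left_of_mem_uIcc (Set.uIoc_subset_uIcc hy)).trans hx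
    have hint : MeasureTheory.IntegrableOn
        (fun y => ‖e‖ * M ^ (n + 1) / n.factorial * |y - s| ^ n) (Set.uIoc s x) := by
      refine (Continuous.integrableOn_uIcc ?_).mono_set Set.uIoc_subset_uIcc
      fun_prop
    calc ‖picardCoeff B s e (n + 1) x‖
        ≤ ∫ y in Set.uIoc s x, ‖B y (picardCoeff B s e n y)‖ :=
          intervalIntegral.norm_integral_le_integral_norm_uIoc
      _ ≤ ∫ y in Set.uIoc s x, ‖e‖ * M ^ (n + 1) / n.factorial * |y - s| ^ n := by
          refine MeasureTheory.setIntegral_mono_on ?_ hint measurableSet_uIoc fun y hy => ?_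
          · exact (Continuous.integrableOn_uIcc
              (hB.clm_apply (continuous_picardCoeff hB s e n)).norm).mono_set
              Set.uIoc_subset_uIcc
          · calc ‖B y (picardCoeff B s e n y)‖ ≤ M * (‖e‖ * (M ^ n * |y - s| ^ n / n.factorial)) :=
                (B y).le_of_opNorm_le_of_le (hM y (hsub y hy)) (ih y (hsub y hy))
              _ = _ := by ring
      _ = ‖e‖ * (M ^ (n + 1) * |x - s| ^ (n + 1) / (n + 1).factorial) := by
          rw [MeasureTheory.integral_const_mul, integral_pow_abs_sub_uIoc, Nat.factorial_succ]
          push_cast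
          field_simp

/-- The solution of `ψ' = k B ψ`, `ψ(s) = e`, as a power series in `k`. -/
def entireSolution (B : ℝ → E →L[ℂ] E) (s : ℝ) (e : E) (x : ℝ) (k : ℂ) : E :=
  ∑' n, k ^ n • picardCoeff B s e n x

omit [CompleteSpace E] in
theorem exists_bound_closedBall {B : ℝ → E →L[ℂ] E} (hB : Continuous B) (s L : ℝ) :
    ∃ M, 0 ≤ M ∧ ∀ x ∈ Metric.closedBall s L, ‖B x‖ ≤ M := by
  obtain ⟨M, hM⟩ := (isCompact_closedBall s L).exists_bound_of_continuousOn hB.continuousOn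
  exact ⟨max M 0, le_max_right _ _, fun x hx => (hM x hx).trans (le_max_left _ _)⟩

omit [CompleteSpace E] in
theorem norm_pow_smul_picardCoeff_le {B : ℝ → E →L[ℂ] E} (hB : Continuous B) {s L M K : ℝ} (e : E)
    (hM : ∀ x ∈ Metric.closedBall s L, ‖B x‖ ≤ M) (n : ℕ) {x : ℝ}
    (hx : x ∈ Metric.closedBall s L) {k : ℂ} (hk : ‖k‖ ≤ K) :
    ‖k ^ n • picardCoeff B s e n x‖ ≤ ‖e‖ * ((K * M * L) ^ n / n.factorial) := by
  have hM0 : 0 ≤ M := (norm_nonneg _).trans (hM x hx)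
  have hxL : |x - s| ≤ L := by simpa [Real.dist_eq] using hx
  have hK : 0 ≤ K := (norm_nonneg k).trans hk
  rw [norm_smul, norm_pow]
  calc ‖k‖ ^ n * ‖picardCoeff B s e n x‖
      ≤ K ^ n * (‖e‖ * (M ^ n * L ^ n / n.factorial)) := by
        refine mul_le_mul (by gcongr) ((norm_picardCoeff_le hB e hM n x hx).trans (by gcongr))
          (norm_nonneg _) (by positivity)
    _ = _ := by ring

theorem differentiable_entireSolution {B : ℝ → E →L[ℂ] E} (hB : Continuous B) (s : ℝ) (e : E)
    (x : ℝ) : Differentiable ℂ (entireSolution B s e x) := by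
  intro k
  obtain ⟨M, hM0, hM⟩ := exists_bound_closedBall hB s |x - s|
  have h := Complex.differentiableOn_tsum_of_summable_norm (U := Metric.ball (0 : ℂ) (‖k‖ + 1))
    (F := fun n k => k ^ n • picardCoeff B s e n x)
    ((Real.summable_pow_div_factorial ((‖k‖ + 1) * M * |x - s|)).mul_left ‖e‖)
    (fun n => by fun_prop) Metric.isOpen_ball
    (fun n w hw => norm_pow_smul_picardCoeff_le hB e hM n (by simp [Real.dist_eq])
      (by simpa using (Metric.mem_ball.1 hw).le))
  exact h.differentiableAt (Metric.isOpen_ball.mem_nhds (by simp))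

omit [CompleteSpace E] in
theorem entireSolution_self (B : ℝ → E →L[ℂ] E) (s : ℝ) (e : E) (k : ℂ) :
    entireSolution B s e s k = e := by
  rw [entireSolution, tsum_eq_single 0]
  · simp [picardCoeff]
  · intro n hn
    obtain ⟨m, rfl⟩ := Nat.exists_eq_succ_of_ne_zero hn
    simp [picardCoeff]

theorem solvesODE_entireSolution {B : ℝ → E →L[ℂ] E} (hB : Continuous B) (s : ℝ) (e : E) (k : ℂ) :
    SolvesODE B k (fun x => entireSolution B s e x k) := by
  intro x
  set L := |x - s| + 1
  obtain ⟨M, hM0, hM⟩ := exists_bound_closedBall hB s L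
  have hsum := (Real.summable_pow_div_factorial (‖k‖ * M * L)).mul_left ‖e‖
  have hball : ∀ {y}, y ∈ Metric.ball s L → y ∈ Metric.closedBall s L :=
    fun h => Metric.ball_subset_closedBall h
  have hxL : x ∈ Metric.ball s L := by simp [Real.dist_eq, L]
  have hs : ∀ y ∈ Metric.ball s L, Summable fun n => k ^ n • picardCoeff B s e n y := fun y hy =>
    Summable.of_norm_bounded hsum fun n =>
      norm_pow_smul_picardCoeff_le hB e hM n (hball hy) le_rfl
  -- The term of index `0` is constant, so only the terms of index `n + 1` are differentiated; their
  -- derivatives reassemble into `k B` applied to the whole series.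
  have hd := hasDerivAt_tsum_of_isPreconnected
    (g := fun n y => k ^ (n + 1) • picardCoeff B s e (n + 1) y)
    (g' := fun n y => k ^ (n + 1) • B y (picardCoeff B s e n y))
    (hsum.mul_left (‖k‖ * M)) Metric.isOpen_ball
    (convex_ball s L).isPreconnected
    (fun n y hy => (hasDerivAt_picardCoeff hB s e n y).const_smul (k ^ (n + 1)))
    (fun n y hy => by
      rw [show k ^ (n + 1) • B y (picardCoeff B s e n y)
        = k • B y (k ^ n • picardCoeff B s e n y) by rw [map_smul, smul_smul, pow_succ'], norm_smul,
        mul_assoc]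
      gcongr
      exact (B y).le_of_opNorm_le_of_le (hM y (hball hy))
        (norm_pow_smul_picardCoeff_le hB e hM n (hball hy) le_rfl))
    hxL ((summable_nat_add_iff 1).2 (hs x hxL)) hxL
  have heq : (fun y => entireSolution B s e y k) =ᶠ[𝓝 x]
      fun y => e + ∑' n, k ^ (n + 1) • picardCoeff B s e (n + 1) y := by
    filter_upwards [Metric.isOpen_ball.mem_nhds hxL] with y hy
    rw [entireSolution, (hs y hy).tsum_eq_zero_add]
    simp [picardCoeff]
  refine HasDerivAt.congr_of_eventuallyEq ?_ heq
  refine (hd.const_add e).congr_deriv ?_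
  simp only [entireSolution]
  rw [ContinuousLinearMap.map_tsum _ (hs x hxL), ← tsum_const_smul'']
  congr 1
  ext n
  rw [map_smul, smul_smul, pow_succ']

end EntireSolution

/-- The closed upper half plane without the origin. -/
def closedUpper : Set ℂ := {k | 0 ≤ k.im ∧ k ≠ 0}

/-- The open upper half plane. -/
def openUpper : Set ℂ := {k | 0 < k.im}

theorem isOpen_openUpper : IsOpen openUpper := isOpen_lt continuous_const Complex.continuous_im

theorem openUpper_subset : openUpper ⊆ closedUpper := fun k hk =>
  ⟨le_of_lt hk, fun h => by simp [openUpper, h] at hk⟩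

/-- Approximate `ψ` by the solutions whose gauge transform equals `e` at `-N`; these are entire in
`k`. The error at `x` is controlled by the error at `-N`, which tends to `0` locally uniformly in
`k` up to the real axis. Uniform limits keep continuity on the closed set and analyticity inside. -/
theorem SkewSystem.regular_of_tendsto [CompleteSpace E] {B : ℝ → E →L[ℂ] E} {r ρ : ℝ → ℝ}
    (hS : SkewSystem B r ρ) {ψ : ℝ → ℂ → E} (hψ : ∀ k ∈ closedUpper, SolvesODE B k (ψ · k)) {e : E}
    (hlim : ∀ k ∈ closedUpper, Tendsto (gauge ρ k (ψ · k)) atBot (𝓝 e)) {γ g : ℝ → ℝ}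
    (hγ : ∀ x, HasDerivAt γ (g x) x) (hγ0 : Tendsto γ atBot (𝓝 0))
    (he : ∀ x, ‖(Complex.I * r x) • e + B x e‖ ≤ g x) (x : ℝ) :
    ContinuousOn (ψ x) closedUpper ∧ DifferentiableOn ℂ (ψ x) openUpper := by
  set F : ℕ → ℂ → E := fun N k =>
    Complex.exp (-(Complex.I * (k * ρ (-N)))) • entireSolution B (-N) e x k with hF
  have hFd : ∀ N, Differentiable ℂ (F N) := fun N => by
    have := differentiable_entireSolution hS.continuous (-N) e x
    exact (by fun_prop : Differentiable ℂ fun k : ℂ =>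
      Complex.exp (-(Complex.I * (k * ρ (-N))))).smul this
  have hest : ∀ k ∈ closedUpper, ∀ N : ℕ, -(N : ℝ) ≤ x →
      ‖ψ x k - F N k‖ ≤ Real.exp (k.im * ρ x) * Real.sqrt (4 * ‖e‖ * ‖k‖ * γ (-N)) := by
    intro k hk N hN
    have hsol := (hψ k hk).sub ((solvesODE_entireSolution hS.continuous (-N) e k).const_smul
      (Complex.exp (-(Complex.I * (k * ρ (-N))))))
    have h1 := hS.antitone_norm_gauge hk.1 hsol hN
    have h2 : gauge ρ k (fun x => ψ x k - Complex.exp (-(Complex.I * (k * ρ (-N)))) •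
        entireSolution B (-N) e x k) (-N) = gauge ρ k (ψ · k) (-N) - e := by
      rw [gauge_sub]
      simp only [gauge, entireSolution_self, smul_smul, ← Complex.exp_add]
      simp
    have h3 : ‖gauge ρ k (ψ · k) (-N) - e‖ ≤ Real.sqrt (4 * ‖e‖ * ‖k‖ * γ (-N)) :=
      Real.le_sqrt_of_sq_le
        (hS.norm_gauge_sub_sq_le hk.1 (hψ k hk) (hlim k hk) hγ hγ0 he (-N))
    simp only [h2] at h1
    have h4 : ‖ψ x k - F N k‖ = Real.exp (k.im * ρ x) * ‖gauge ρ k (fun x => ψ x k -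
        Complex.exp (-(Complex.I * (k * ρ (-N)))) • entireSolution B (-N) e x k) x‖ := by
      rw [gauge, norm_smul, Complex.norm_exp, ← mul_assoc, ← Real.exp_add]
      simp [hF]
    rw [h4]
    exact mul_le_mul_of_nonneg_left (h1.trans h3) (Real.exp_nonneg _)
  have hunif : TendstoLocallyUniformlyOn F (ψ x) atTop closedUpper := by
    rw [Metric.tendstoLocallyUniformlyOn_iff]
    intro ε hε k hk
    set K := ‖k‖ + 1
    refine ⟨closedUpper ∩ Metric.ball 0 K, inter_mem_nhdsWithin _
      (Metric.isOpen_ball.mem_nhds (by simp [K])), ?_⟩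
    have hl : Tendsto (fun N : ℕ => Real.exp (K * |ρ x|) *
        Real.sqrt (4 * ‖e‖ * K * γ (-N))) atTop (𝓝 0) := by
      have hN : Tendsto (fun N : ℕ => -(N : ℝ)) atTop atBot :=
        tendsto_neg_atTop_atBot.comp tendsto_natCast_atTop_atTop
      have := ((((hγ0.comp hN).const_mul (4 * ‖e‖ * K)).sqrt).const_mul (Real.exp (K * |ρ x|)))
      simpa using this
    have hγnn : ∀ y, 0 ≤ γ y := by
      have hmono : Monotone γ := monotone_of_deriv_nonneg (fun y => (hγ y).differentiableAt)
        fun y => by rw [(hγ y).deriv]; exact (norm_nonneg _).trans (he y)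
      exact fun y => le_of_tendsto hγ0 ((eventually_le_atBot y).mono fun z hz => hmono hz)
    filter_upwards [hl.eventually_lt_const hε, eventually_ge_atTop ⌈-x⌉₊] with N hN hNx k' hk'
    have hk'K : ‖k'‖ ≤ K := by simpa using (Metric.mem_ball.1 hk'.2).le
    have hNx' : -(N : ℝ) ≤ x := by
      have := Nat.ceil_le.1 hNx
      linarith
    rw [dist_eq_norm]
    refine (hest k' hk'.1 N hNx').trans_lt (lt_of_le_of_lt ?_ hN)
    have h1 : k'.im * ρ x ≤ K * |ρ x| := by
      refine (le_abs_self _).trans ?_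
      rw [abs_mul]
      exact mul_le_mul_of_nonneg_right ((Complex.abs_im_le_norm k').trans hk'K) (abs_nonneg _)
    have h2 := hγnn (-N)
    gcongr
  refine ⟨hunif.continuousOn (Frequently.of_forall fun N => (hFd N).continuous.continuousOn), ?_⟩
  exact (hunif.mono openUpper_subset).differentiableOn
    (Eventually.of_forall fun N => (hFd N).differentiableOn) isOpen_openUpper

end LinearODE

end CCSPE

end

/-! ### Uniqueness of the analytic extensions from the punctured real axis. -/

noncomputable section

namespace CCSPE

open Filter Topology

/-- A function that is analytic in the upper half plane, continuous up to the real axis without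
`0`, and zero there, vanishes at the centre of each square standing on that boundary. -/
theorem eq_zero_of_im_lt_re {h : ℂ → ℂ} (hd : DifferentiableOn ℂ h openUpper)
    (hc : ContinuousOn h closedUpper) (h0 : ∀ x : ℝ, x ≠ 0 → h x = 0) {c : ℂ} (hc0 : 0 < c.im)
    (hcre : c.im < c.re) : h c = 0 := by
  -- With half-side `Im c`, the square centred at `c` has its bottom edge on the real axis; `Im c <
  -- Re c` keeps that edge away from `0`.
  set y := c.im
  set Q : Set ℂ := Set.Ioo (-y) y ×ℂ Set.Ioo (-y) y with hQ
  have hcl : closure Q = Set.Icc (-y) y ×ℂ Set.Icc (-y) y := by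
    rw [hQ, Complex.closure_reProdIm, closure_Ioo (by linarith)]
  have hfr : ∀ z ∈ frontier Q, (|z.re| ≤ y ∧ |z.im| ≤ y) ∧
      (z.re = y ∨ z.re = -y ∨ z.im = y ∨ z.im = -y) := by
    intro z hz
    have h1 := frontier_subset_closure hz
    rw [hcl, Complex.mem_reProdIm] at h1
    have h2 : z ∉ Q := by
      have ho : IsOpen Q := isOpen_Ioo.reProdIm isOpen_Ioo
      rw [ho.frontier_eq] at hz
      exact hz.2
    rw [hQ, Complex.mem_reProdIm] at h2
    simp only [Set.mem_Icc, Set.mem_Ioo] at h1 h2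
    refine ⟨⟨abs_le.2 h1.1, abs_le.2 h1.2⟩, ?_⟩
    by_contra! hne
    obtain ⟨⟨ha, hb⟩, hc', hd'⟩ := h1
    exact h2 ⟨⟨lt_of_le_of_ne ha (Ne.symm hne.2.1), lt_of_le_of_ne hb hne.1⟩,
      lt_of_le_of_ne hc' (Ne.symm hne.2.2.2), lt_of_le_of_ne hd' hne.2.2.1⟩
  have hmem : ∀ w : ℂ, |w.re| ≤ y → |w.im| ≤ y → c + w ∈ closedUpper := by
    intro w hw1 hw2
    refine ⟨?_, fun h => ?_⟩
    · have := (abs_le.1 hw2).1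
      rw [Complex.add_im]
      linarith
    · have h' := congrArg Complex.re h
      have := (abs_le.1 hw1).1
      rw [Complex.add_re, Complex.zero_re] at h'
      linarith
  have hmemo : ∀ w : ℂ, |w.im| < y → c + w ∈ openUpper := by
    intro w hw2
    have := (abs_lt.1 hw2).1
    show 0 < (c + w).im
    rw [Complex.add_im]
    linarith
  have hzero : ∀ w : ℂ, |w.re| ≤ y → w.im = -y → h (c + w) = 0 := by
    intro w hw1 hw2
    have him : (c + w).im = 0 := by rw [Complex.add_im, hw2]; ring
    have hre : 0 < (c + w).re := by
      have := (abs_le.1 hw1).1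
      rw [Complex.add_re]
      linarith
    have : c + w = ((c + w).re : ℂ) := Complex.ext (by simp) (by simpa using him)
    rw [this]
    exact h0 _ hre.ne'
  have key : ∀ ω : ℂ, (ω = 1 ∨ ω = -1 ∨ ω = Complex.I ∨ ω = -Complex.I) →
      DiffContOnCl ℂ (fun z => h (c + ω * z)) Q := by
    intro ω hω
    have hcoord : ∀ z : ℂ, (|(ω * z).re| = |z.re| ∧ |(ω * z).im| = |z.im|) ∨
        (|(ω * z).re| = |z.im| ∧ |(ω * z).im| = |z.re|) := by
      intro z
      rcases hω with rfl | rfl | rfl | rfl <;> simp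
    refine ⟨?_, ?_⟩
    · refine hd.comp (by fun_prop) fun z hz => hmemo _ ?_
      rw [hQ, Complex.mem_reProdIm] at hz
      have h1 := abs_lt.2 hz.1
      have h2 := abs_lt.2 hz.2
      rcases hcoord z with h | h <;> rw [h.2] <;> assumption
    · refine hc.comp (by fun_prop) fun z hz => ?_
      rw [hcl, Complex.mem_reProdIm] at hz
      have h1 := abs_le.2 hz.1
      have h2 := abs_le.2 hz.2
      rcases hcoord z with h | h
      · exact hmem _ (by rwa [h.1]) (by rwa [h.2])
      · exact hmem _ (by rwa [h.1]) (by rwa [h.2])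
  -- The product of `h (c + ω z)` over the four quarter-turns `ω` vanishes on the whole boundary of
  -- the square, because each side is rotated onto the bottom edge by one `ω`. The maximum principle
  -- makes it vanish at `z = 0`, where it equals `h(c)⁴`.
  have hdiff := (((key 1 (by simp)).smul (key (-1) (by simp))).smul
    ((key Complex.I (by simp)).smul (key (-Complex.I) (by simp))))
  have hbdd : Bornology.IsBounded Q :=
    (Metric.isBounded_Ioo _ _).reProdIm (Metric.isBounded_Ioo _ _)
  have hmax := Complex.norm_le_of_forall_mem_frontier_norm_le hbdd hdiff (C := 0)
    (fun z hz => by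
      obtain ⟨⟨h1, h2⟩, h3⟩ := hfr z hz
      rw [norm_le_zero_iff]
      simp only [smul_eq_mul, mul_eq_zero]
      rcases h3 with h3 | h3 | h3 | h3
      · exact Or.inr (Or.inr (hzero _ (by simpa using h2) (by simp [h3])))
      · exact Or.inr (Or.inl (hzero _ (by simpa using h2) (by simp [h3])))
      · exact Or.inl (Or.inr (hzero _ (by simpa using h1) (by simp [h3])))
      · exact Or.inl (Or.inl (hzero _ (by simpa using h1) (by simp [h3]))))
    (z := 0) (subset_closure (by rw [hQ, Complex.mem_reProdIm]; simp [hc0]))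
  rw [norm_le_zero_iff] at hmax
  simpa using hmax

/-- The square argument covers the open wedge `0 < Im z < Re z`; the identity theorem carries the
vanishing to the half plane. -/
theorem eq_zero_of_boundary_eq_zero {h : ℂ → ℂ} (hd : DifferentiableOn ℂ h openUpper)
    (hc : ContinuousOn h closedUpper) (h0 : ∀ x : ℝ, x ≠ 0 → h x = 0) {c : ℂ} (hc0 : 0 < c.im) :
    h c = 0 := by
  have hconn : IsPreconnected openUpper := (convex_halfSpace_im_gt 0).isPreconnected
  have hz : (2 + Complex.I : ℂ) ∈ openUpper := by simp [openUpper]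
  refine (hd.analyticOnNhd isOpen_openUpper).eqOn_zero_of_preconnected_of_eventuallyEq_zero hconn
    hz ?_ hc0
  have ho : IsOpen {z : ℂ | 0 < z.im ∧ z.im < z.re} :=
    (isOpen_lt continuous_const Complex.continuous_im).inter
      (isOpen_lt Complex.continuous_im Complex.continuous_re)
  filter_upwards [ho.mem_nhds (show (2 + Complex.I : ℂ) ∈ _ by simp)] with z hz
  exact eq_zero_of_im_lt_re hd hc h0 hz.1 hz.2

/-- Since `a` is defined by a choice among extensions, this uniqueness is what identifies it with an
explicit formula. -/
theorem IsUpperExtension.eq_of_im_pos {f : ℝ → Mat2} {F G : ℂ → Mat2} (hF : IsUpperExtension f F)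
    (hG : IsUpperExtension f G) {k : ℂ} (hk : 0 < k.im) : F k = G k := by
  ext i j
  refine sub_eq_zero.1 (eq_zero_of_boundary_eq_zero (h := fun k => F k i j - G k i j)
    ((hF.analytic i j).sub (hG.analytic i j)) ?_ ?_ hk)
  · exact (continuousOn_pi.1 (continuousOn_pi.1 hF.continuousOn i) j).sub
      (continuousOn_pi.1 (continuousOn_pi.1 hG.continuousOn i) j)
  · intro x hx
    simp only [hF.boundary x hx, hG.boundary x hx, sub_self]

theorem IsLowerExtension.neg {f : ℝ → Mat2} {F : ℂ → Mat2} (hF : IsLowerExtension f F) :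
    IsUpperExtension (fun x => f (-x)) (fun k => F (-k)) where
  analytic i j := (hF.analytic i j).comp (by fun_prop) fun k hk => by simpa using hk
  continuousOn := hF.continuousOn.comp (by fun_prop) fun k hk => by simpa using hk
  boundary k hk := by simpa using hF.boundary (-k) (by simpa using hk)

theorem IsLowerExtension.eq_of_im_neg {f : ℝ → Mat2} {F G : ℂ → Mat2} (hF : IsLowerExtension f F)
    (hG : IsLowerExtension f G) {k : ℂ} (hk : k.im < 0) : F k = G k := by
  simpa using hF.neg.eq_of_im_pos hG.neg (k := -k) (by simpa using hk)

end CCSPE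

end

noncomputable section

namespace CCSPE

open Matrix
open scoped ComplexOrder

/-! ### Ranks of block matrices. -/

section Rank

theorem rank_eq_two_of_injective {M : Mat42} (hM : ∀ v, M *ᵥ v = 0 → v = 0) : M.rank = 2 := by
  have hinj : Function.Injective M.mulVecLin :=
    (injective_iff_map_eq_zero _).2 fun v hv => hM v (by simpa using hv)
  rw [Matrix.rank, LinearMap.finrank_range_of_inj hinj]
  simp

/-- The range of `N` lies in the kernel of `M'ᴴ`, and both have dimension `2`, so they agree. Hence
`M v + N w = 0` is solvable for `w`, uniquely, exactly when `M'ᴴ M v = 0`: the kernels of `(M, N)`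
and `M'ᴴ M` are isomorphic, on spaces of dimension `4` and `2`. -/
theorem rank_fromCols_eq {M N M' : Mat42} (hN : ∀ v, N *ᵥ v = 0 → v = 0)
    (hM' : ∀ v, M' *ᵥ v = 0 → v = 0) (h : M'ᴴ * N = 0) :
    (fromCols M N).rank = 2 + (M'ᴴ * M).rank := by
  have hker : LinearMap.range N.mulVecLin = LinearMap.ker (M'ᴴ).mulVecLin := by
    refine Submodule.eq_of_le_of_finrank_eq ?_ ?_
    · rintro _ ⟨v, rfl⟩
      simp [h]
    · have h1 : Module.finrank ℂ (LinearMap.range N.mulVecLin) = 2 := rank_eq_two_of_injective hN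
      have h2 : Module.finrank ℂ (LinearMap.range (M'ᴴ).mulVecLin) = 2 := by
        have := rank_conjTranspose M'
        rw [rank_eq_two_of_injective hM'] at this
        exact this
      have h3 := LinearMap.finrank_range_add_finrank_ker (M'ᴴ).mulVecLin
      simp only [Module.finrank_fintype_fun_eq_card, Fintype.card_sum, Fintype.card_fin] at h3
      omega
  set p : (Fin 2 ⊕ Fin 2 → ℂ) →ₗ[ℂ] (Fin 2 → ℂ) := LinearMap.funLeft ℂ ℂ Sum.inl
  have hmap : (LinearMap.ker (fromCols M N).mulVecLin).map p =
      LinearMap.ker (M'ᴴ * M).mulVecLin := by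
    ext v
    simp only [Submodule.mem_map, LinearMap.mem_ker, mulVecLin_apply, fromCols_mulVec]
    constructor
    · rintro ⟨w, hw, rfl⟩
      have := congrArg (M'ᴴ *ᵥ ·) hw
      simpa [mulVec_add, h, p, LinearMap.funLeft] using this
    · intro hv
      have hmem : M *ᵥ v ∈ LinearMap.range N.mulVecLin := by
        rw [hker]
        simpa using hv
      obtain ⟨w, hw⟩ := hmem
      refine ⟨Sum.elim v (-w), ?_, rfl⟩
      rw [mulVecLin_apply] at hw
      rw [Sum.elim_comp_inl, Sum.elim_comp_inr, mulVec_neg, hw, add_neg_cancel]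
  have hinj : Function.Injective (p.domRestrict (LinearMap.ker (fromCols M N).mulVecLin)) := by
    refine (injective_iff_map_eq_zero _).2 ?_
    rintro ⟨w, hw⟩ hpw
    have h1 : w ∘ Sum.inl = 0 := hpw
    have h2 : N *ᵥ (w ∘ Sum.inr) = 0 := by
      simpa [fromCols_mulVec, h1] using hw
    have h3 := hN _ h2
    ext i
    rcases i with i | i
    · exact congrFun h1 i
    · exact congrFun h3 i
  have h1 := LinearMap.finrank_range_of_inj hinj
  rw [LinearMap.range_domRestrict, hmap] at h1
  have h2 := LinearMap.finrank_range_add_finrank_ker (fromCols M N).mulVecLin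
  have h3 := LinearMap.finrank_range_add_finrank_ker (M'ᴴ * M).mulVecLin
  simp only [Module.finrank_fintype_fun_eq_card, Fintype.card_sum, Fintype.card_fin] at h2 h3
  change (fromCols M N).rank + _ = _ at h2
  change (M'ᴴ * M).rank + _ = _ at h3
  omega

theorem rank_fromCols_comm (M N : Mat42) : (fromCols M N).rank = (fromCols N M).rank := by
  have : fromCols N M = (fromCols M N).submatrix (Equiv.refl _) (Equiv.sumComm (Fin 2) (Fin 2)) := by
    ext i (j | j) <;> simp
  rw [this, rank_submatrix]

theorem rank_map_star (M : Mat2) : (M.map star).rank = M.rank := by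
  rw [← rank_conjTranspose M, ← rank_transpose Mᴴ]
  rfl

theorem det_eq_zero_iff_rank_lt {M : Mat2} : M.det = 0 ↔ M.rank < 2 := by
  constructor
  · intro h
    refine lt_of_le_of_ne (by simpa using M.rank_le_card_width) fun hr => ?_
    have hsurj : LinearMap.range M.mulVecLin = ⊤ :=
      Submodule.eq_top_of_finrank_eq (by
        rw [Module.finrank_fintype_fun_eq_card]
        exact hr)
    have : IsUnit M := by
      rw [← mulVec_surjective_iff_isUnit]
      exact LinearMap.range_eq_top.1 hsurj
    exact ((isUnit_iff_isUnit_det M).1 this).ne_zero h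
  · intro h
    by_contra hd
    have := rank_of_isUnit M ((isUnit_iff_isUnit_det M).2 (Ne.isUnit hd))
    simp at this
    omega

theorem rank_eq_zero_iff' {n : Type*} [Fintype n] [DecidableEq n] (M : Matrix n n ℂ) :
    M.rank = 0 ↔ M = 0 := by
  constructor
  · intro h
    rw [Matrix.rank, Submodule.finrank_eq_zero, LinearMap.range_eq_bot] at h
    ext i j
    have := congrFun (LinearMap.congr_fun h (Pi.single j 1)) i
    simpa using this
  · rintro rfl
    exact rank_zero

end Rank

/-! ### Entrywise calculus for matrix-valued functions. -/

section MatrixDeriv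

variable {l m n : Type*}

/-- The entrywise derivative of a matrix-valued function of a real variable. -/
def HasMatDerivAt (A : ℝ → Matrix m n ℂ) (A' : Matrix m n ℂ) (x : ℝ) : Prop :=
  ∀ i j, HasDerivAt (fun y => A y i j) (A' i j) x

theorem hasMatDerivAt_const (A : Matrix m n ℂ) (x : ℝ) : HasMatDerivAt (fun _ => A) 0 x :=
  fun i j => hasDerivAt_const x (A i j)

theorem HasMatDerivAt.mul [Fintype m] {A : ℝ → Matrix l m ℂ} {B : ℝ → Matrix m n ℂ}
    {A' : Matrix l m ℂ} {B' : Matrix m n ℂ} {x : ℝ} (hA : HasMatDerivAt A A' x)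
    (hB : HasMatDerivAt B B' x) :
    HasMatDerivAt (fun y => A y * B y) (A' * B x + A x * B') x := by
  intro i j
  simp only [mul_apply, Matrix.add_apply, ← Finset.sum_add_distrib]
  exact HasDerivAt.fun_sum fun k _ => (hA i k).mul (hB k j)

theorem HasMatDerivAt.conjTranspose {A : ℝ → Matrix m n ℂ} {A' : Matrix m n ℂ} {x : ℝ}
    (hA : HasMatDerivAt A A' x) : HasMatDerivAt (fun y => (A y)ᴴ) A'ᴴ x :=
  fun i j => (hA j i).star

theorem HasMatDerivAt.map_star {A : ℝ → Matrix m n ℂ} {A' : Matrix m n ℂ} {x : ℝ}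
    (hA : HasMatDerivAt A A' x) : HasMatDerivAt (fun y => (A y).map star) (A'.map star) x :=
  fun i j => (hA i j).star

theorem eq_of_hasMatDerivAt_zero {A : ℝ → Matrix m n ℂ} (h : ∀ x, HasMatDerivAt A 0 x) (x y : ℝ) :
    A x = A y := by
  ext i j
  exact is_const_of_deriv_eq_zero (fun x => (h x i j).differentiableAt)
    (fun x => (h x i j).deriv) x y

end MatrixDeriv

/-! ### Algebra of the Lax matrices: skewness, the square of `X`, the quaternionic symmetry. -/

section LaxMatrices

/-- `U` is a norm times a unitary matrix. This makes `X₁²` scalar and lets `U Uᴴ` be moved past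
`U_x` in the adjoint of `T`. -/
theorem potential_mul_conjTranspose (v : EuclideanSpace ℂ (Fin 2)) :
    potential v * (potential v)ᴴ = ((‖v‖ ^ 2 : ℝ) : ℂ) • (1 : Mat2) := by
  rw [EuclideanSpace.norm_sq_eq]
  ext i j
  fin_cases i <;> fin_cases j <;>
    simp [potential, mul_apply, Fin.sum_univ_two, ← Complex.mul_conj'] <;>
    ring_nf <;> simp only [Complex.I_sq] <;> ring

theorem conjTranspose_mul_potential (v : EuclideanSpace ℂ (Fin 2)) :
    (potential v)ᴴ * potential v = ((‖v‖ ^ 2 : ℝ) : ℂ) • (1 : Mat2) := by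
  rw [EuclideanSpace.norm_sq_eq]
  ext i j
  fin_cases i <;> fin_cases j <;>
    simp [potential, mul_apply, Fin.sum_univ_two, ← Complex.mul_conj'] <;>
    ring_nf <;> simp only [Complex.I_sq] <;> ring

theorem laxX_eq_smul (u : VField) (x t : ℝ) (k : ℂ) : laxX u x t k = k • laxX u x t 1 := by
  simp [laxX, fromBlocks_smul, smul_smul, mul_comm]

theorem conjTranspose_laxX (u : VField) (x t : ℝ) (k : ℂ) :
    (laxX u x t (star k))ᴴ = -laxX u x t k := by
  simp [laxX, fromBlocks_conjTranspose, fromBlocks_neg, conjTranspose_smul]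

theorem conjTranspose_laxT (u : VField) (x t : ℝ) (k : ℂ) :
    (laxT u x t (star k))ᴴ = -laxT u x t k := by
  simp only [laxT, potential_mul_conjTranspose, conjTranspose_mul_potential,
    fromBlocks_conjTranspose, fromBlocks_neg, conjTranspose_smul, conjTranspose_sub,
    conjTranspose_add, conjTranspose_one, smul_mul_assoc, one_mul]
  congr 1 <;> ext i j <;> simp [conjTranspose_apply] <;> ring

theorem laxX_mul_self (u : VField) (x t : ℝ) :
    laxX u x t 1 * laxX u x t 1 = -((1 + ‖ux u x t‖ ^ 2 : ℝ) : ℂ) • (1 : Mat4) := by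
  simp only [laxX, fromBlocks_multiply, ← fromBlocks_one, fromBlocks_smul, smul_mul_smul_comm,
    potential_mul_conjTranspose, conjTranspose_mul_potential]
  congr 1 <;> simp [smul_smul, add_smul, add_comm]

/-- The matrix of the quaternionic symmetry `k ↦ -k*` on `2 × 2` blocks. -/
def symp : Mat2 := !![0, 1; -1, 0]

theorem symp_mul_transpose : symp * sympᵀ = 1 := by
  ext i j
  fin_cases i <;> fin_cases j <;> simp [symp, mul_apply, Fin.sum_univ_two]

theorem transpose_mul_symp : sympᵀ * symp = 1 := by
  ext i j
  fin_cases i <;> fin_cases j <;> simp [symp, mul_apply, Fin.sum_univ_two]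

theorem symp_map_star : symp.map star = symp := by
  ext i j
  fin_cases i <;> fin_cases j <;> simp [symp]

/-- Two diagonal copies of `symp`. -/
def symp₄ : Mat4 := fromBlocks symp 0 0 symp

theorem symp₄_map_star : symp₄.map star = symp₄ := by
  rw [symp₄, fromBlocks_map, symp_map_star, Matrix.map_zero _ (star_zero ℂ)]

theorem transpose_mul_symp₄ : symp₄ᵀ * symp₄ = 1 := by
  simp [symp₄, fromBlocks_transpose, fromBlocks_multiply, transpose_mul_symp]

theorem conjTranspose_potential (v : EuclideanSpace ℂ (Fin 2)) : (potential v)ᴴ =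
    !![Complex.I * star (v 0), -Complex.I * v 1; Complex.I * star (v 1), Complex.I * v 0] := by
  ext i j
  fin_cases i <;> fin_cases j <;> simp [potential]

/-- `U` is `-i` times a quaternion in matrix form. Conjugation by `symp` sends a quaternion matrix
to its complex conjugate; the factor `-i` costs a sign, which `k ↦ -k*` compensates. -/
theorem symp₄_mul_laxX (u : VField) (x t : ℝ) (k : ℂ) :
    symp₄ * laxX u x t (-star k) = (laxX u x t k).map star * symp₄ := by
  simp only [laxX, symp₄, conjTranspose_potential, fromBlocks_multiply, fromBlocks_map]
  congr 1 <;> ext i j <;> fin_cases i <;> fin_cases j <;>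
    simp [symp, potential, mul_apply, Fin.sum_univ_two]

end LaxMatrices

end CCSPE

end

noncomputable section

namespace CCSPE

open Matrix Filter Topology

/-! ### The scattering problem as a skew-adjoint system with phase `ξ`. -/

section ScatteringProblem

variable {u : VField}

theorem IsSolution.continuous_ux (hu : IsSolution u) (t : ℝ) : Continuous fun x => ux u x t := by
  have h : ContDiff ℝ 2 fun y => u y t :=
    hu.contDiff.comp (contDiff_id.prodMk contDiff_const)
  exact h.continuous_deriv (by norm_num)

theorem exists_primitive_tendsto_zero {h : ℝ → ℝ} (hc : Continuous h)
    (hi : MeasureTheory.Integrable h) :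
    ∃ γ : ℝ → ℝ, (∀ x, HasDerivAt γ (h x) x) ∧ Tendsto γ atBot (𝓝 0) := by
  refine ⟨fun x => (∫ y in (0 : ℝ)..x, h y) + ∫ y in Set.Iic (0 : ℝ), h y, fun x => ?_, ?_⟩
  · exact ((hc.integral_hasStrictDerivAt 0 x).hasDerivAt).add_const _
  · have := MeasureTheory.intervalIntegral_tendsto_integral_Iic (μ := MeasureTheory.volume) 0
      hi.integrableOn tendsto_id
    have h2 := (this.neg).add_const (∫ y in Set.Iic (0 : ℝ), h y)
    rw [neg_add_cancel] at h2
    refine h2.congr fun x => ?_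
    rw [id, intervalIntegral.integral_symm x 0]

theorem sqrt_one_add_sq_sub_one_le {s : ℝ} (hs : 0 ≤ s) : √(1 + s ^ 2) - 1 ≤ s := by
  have : √(1 + s ^ 2) ≤ 1 + s := by
    rw [Real.sqrt_le_left (by linarith)]
    nlinarith
  linarith

theorem hasDerivAt_xi (hu : IsSolution u) (hd : Decays u) (t x : ℝ) :
    HasDerivAt (fun y => xi u y t) (√(1 + ‖ux u x t‖ ^ 2)) x := by
  set h : ℝ → ℝ := fun y => √(1 + ‖ux u y t‖ ^ 2) - 1
  have hc : Continuous h := by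
    have := hu.continuous_ux t
    fun_prop
  have hi : MeasureTheory.Integrable h := by
    refine (hd.ux_integrable t).norm.mono' hc.aestronglyMeasurable (MeasureTheory.ae_of_all _ fun y => ?_)
    rw [Real.norm_eq_abs, abs_of_nonneg (by simp [h])]
    exact sqrt_one_add_sq_sub_one_le (norm_nonneg _)
  have heq : (fun y => xi u y t) =
      fun y => y - ((∫ z in Set.Ioi (0 : ℝ), h z) - ∫ z in (0 : ℝ)..y, h z) := by
    ext y
    have := intervalIntegral.integral_interval_add_Ioi (a := 0) (b := y) (f := h)
      (μ := MeasureTheory.volume) hi.integrableOn hi.integrableOn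
    rw [← this, add_sub_cancel_left, xi]
  rw [heq]
  refine ((hasDerivAt_id x).sub
    (((hc.integral_hasStrictDerivAt 0 x).hasDerivAt).const_sub _)).congr_deriv ?_
  simp [h]

/-- The Lax matrix `X` at `k = 1`, as an operator. -/
def laxOp (u : VField) (t x : ℝ) :
    EuclideanSpace ℂ (Fin 2 ⊕ Fin 2) →L[ℂ] EuclideanSpace ℂ (Fin 2 ⊕ Fin 2) :=
  toEuclideanCLM (𝕜 := ℂ) (laxX u x t 1)

theorem laxOp_toLp (t x : ℝ) (w : Fin 2 ⊕ Fin 2 → ℂ) :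
    laxOp u t x (WithLp.toLp 2 w) = WithLp.toLp 2 (laxX u x t 1 *ᵥ w) := rfl

theorem laxOp_laxOp (t x : ℝ) (v : EuclideanSpace ℂ (Fin 2 ⊕ Fin 2)) :
    laxOp u t x (laxOp u t x v) = -((1 + ‖ux u x t‖ ^ 2 : ℝ) : ℂ) • v := by
  have h : laxOp u t x * laxOp u t x = -((1 + ‖ux u x t‖ ^ 2 : ℝ) : ℂ) • 1 := by
    rw [laxOp, ← map_mul, laxX_mul_self, map_smul, map_one]
  exact DFunLike.congr_fun h v

theorem inner_laxOp (t x : ℝ) (v w : EuclideanSpace ℂ (Fin 2 ⊕ Fin 2)) :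
    inner ℂ (laxOp u t x v) w = -inner ℂ v (laxOp u t x w) := by
  have h : star (laxOp u t x) = -laxOp u t x := by
    rw [laxOp, ← map_star, star_eq_conjTranspose, ← map_neg]
    have := conjTranspose_laxX u x t 1
    rw [star_one] at this
    rw [this]
  rw [← ContinuousLinearMap.adjoint_inner_right, ← ContinuousLinearMap.star_eq_adjoint, h]
  simp

/-- Skewness turns `‖X₁ v‖²` into `-⟨v, X₁² v⟩`, and `X₁²` is scalar. -/
theorem norm_laxOp (t x : ℝ) (v : EuclideanSpace ℂ (Fin 2 ⊕ Fin 2)) :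
    ‖laxOp u t x v‖ = √(1 + ‖ux u x t‖ ^ 2) * ‖v‖ := by
  have h : inner ℂ (laxOp u t x v) (laxOp u t x v) = ((1 + ‖ux u x t‖ ^ 2 : ℝ) : ℂ) * inner ℂ v v := by
    rw [inner_laxOp, laxOp_laxOp, inner_smul_right]
    ring
  rw [inner_self_eq_norm_sq_to_K, inner_self_eq_norm_sq_to_K] at h
  have h' : ‖laxOp u t x v‖ ^ 2 = (1 + ‖ux u x t‖ ^ 2) * ‖v‖ ^ 2 := by
    refine Complex.ofReal_injective ?_
    push_cast at h ⊢
    exact h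
  rw [← Real.sqrt_sq (norm_nonneg (laxOp u t x v)), h', Real.sqrt_mul (by positivity),
    Real.sqrt_sq (norm_nonneg v)]

theorem continuous_potential : Continuous potential := by
  refine continuous_matrix fun i j => ?_
  fin_cases i <;> fin_cases j <;> simp only [potential] <;> simp <;> fun_prop

theorem skewSystem_laxOp (hu : IsSolution u) (hd : Decays u) (t : ℝ) :
    SkewSystem (laxOp u t) (fun x => √(1 + ‖ux u x t‖ ^ 2)) (fun x => xi u x t) where
  continuous := by
    have h1 : Continuous fun x => laxX u x t 1 := by
      have := continuous_potential.comp (hu.continuous_ux t)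
      exact Continuous.matrix_fromBlocks continuous_const (this.const_smul (1 : ℂ))
        ((this.matrix_conjTranspose).const_smul (-1 : ℂ)) continuous_const
    have h2 : Continuous fun M : Mat4 => (toEuclideanCLM (𝕜 := ℂ) (n := Fin 2 ⊕ Fin 2)) M :=
      LinearMap.continuous_of_finiteDimensional
        ((toEuclideanCLM (𝕜 := ℂ) (n := Fin 2 ⊕ Fin 2)).toAlgEquiv.toLinearMap)
    exact h2.comp h1
  skew := inner_laxOp t
  bound x v := (norm_laxOp t x v).le
  phase := hasDerivAt_xi hu hd t

end ScatteringProblem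

/-! ### Jost families: uniqueness, injectivity and regularity in `k`. -/

section Families

variable {u : VField}

/-- The normalization `E` of a family of Jost solutions with phase `e^{isθ}`: the columns of `E`
are eigenvectors, for the eigenvalue `-is`, of the Lax matrix at vanishing field. -/
structure IsNormalization (s : ℝ) (E : Mat42) : Prop where
  injective : ∀ v, E *ᵥ v = 0 → v = 0
  inner_eq : ∀ (u : VField) (t x : ℝ) (v : Fin 2 → ℂ),
    inner ℂ (WithLp.toLp 2 (E *ᵥ v)) (laxOp u t x (WithLp.toLp 2 (E *ᵥ v))) =
      -(s * Complex.I) * ((‖WithLp.toLp 2 (E *ᵥ v)‖ ^ 2 : ℝ) : ℂ)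

theorem isNormalization_fst : IsNormalization 1 (fromRows (1 : Mat2) (0 : Mat2)) where
  injective v hv := by
    rw [fromRows_mulVec, one_mulVec] at hv
    ext i
    exact congrFun hv (Sum.inl i)
  inner_eq u t x v := by
    rw [laxOp_toLp, EuclideanSpace.norm_sq_eq, EuclideanSpace.inner_toLp_toLp, fromRows_mulVec,
      one_mulVec, zero_mulVec, laxX, fromBlocks_mulVec]
    simp [dotProduct, Fin.sum_univ_two, ← Complex.mul_conj']
    ring

theorem isNormalization_snd : IsNormalization (-1) (fromRows (0 : Mat2) (1 : Mat2)) where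
  injective v hv := by
    rw [fromRows_mulVec, one_mulVec] at hv
    ext i
    exact congrFun hv (Sum.inr i)
  inner_eq u t x v := by
    rw [laxOp_toLp, EuclideanSpace.norm_sq_eq, EuclideanSpace.inner_toLp_toLp, fromRows_mulVec,
      one_mulVec, zero_mulVec, laxX, fromBlocks_mulVec]
    simp [dotProduct, Fin.sum_univ_two, smul_mulVec, ← Complex.mul_conj']
    ring

/-- The two summands have norm `r ‖e‖` and real inner product `-r ‖e‖²`, so the square of the left
side is `2 r (r - 1) ‖e‖²`, and `r (r - 1) ≤ r² - 1 = ‖u_x‖²`. The resulting bound is integrable in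
`x`, as the energy estimate requires. -/
theorem IsNormalization.norm_le {s : ℝ} {E : Mat42} (hE : IsNormalization s E) (hs : s * s = 1)
    (t x : ℝ) (v : Fin 2 → ℂ) :
    ‖(Complex.I * (√(1 + ‖ux u x t‖ ^ 2) : ℝ)) • WithLp.toLp 2 (E *ᵥ v) +
        (s : ℂ) • laxOp u t x (WithLp.toLp 2 (E *ᵥ v))‖ ≤
      2 * ‖WithLp.toLp 2 (E *ᵥ v)‖ * ‖ux u x t‖ := by
  set e : EuclideanSpace ℂ (Fin 2 ⊕ Fin 2) := WithLp.toLp 2 (E *ᵥ v)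
  set r := √(1 + ‖ux u x t‖ ^ 2)
  have hr1 : 1 ≤ r := Real.one_le_sqrt.2 (by nlinarith [sq_nonneg ‖ux u x t‖])
  have hr2 : r ^ 2 = 1 + ‖ux u x t‖ ^ 2 := Real.sq_sqrt (by positivity)
  have hin : inner ℂ e (laxOp u t x e) = -(s * Complex.I) * ((‖e‖ ^ 2 : ℝ) : ℂ) :=
    hE.inner_eq u t x v
  have hnorm := norm_add_sq (𝕜 := ℂ) ((Complex.I * (r : ℂ)) • e) ((s : ℂ) • laxOp u t x e)
  have hcross : RCLike.re (inner ℂ ((Complex.I * (r : ℂ)) • e) ((s : ℂ) • laxOp u t x e)) =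
      -(r * ‖e‖ ^ 2) := by
    have hs' : (s : ℂ) * s = 1 := by exact_mod_cast hs
    have : inner ℂ ((Complex.I * (r : ℂ)) • e) ((s : ℂ) • laxOp u t x e) =
        ((-(r * ‖e‖ ^ 2) : ℝ) : ℂ) := by
      rw [inner_smul_left, inner_smul_right, hin]
      simp only [map_mul, Complex.conj_I, Complex.conj_ofReal]
      push_cast
      linear_combination (r : ℂ) * ‖e‖ ^ 2 * (s : ℂ) * s * Complex.I_sq - r * ‖e‖ ^ 2 * hs'
    rw [this]
    rfl
  have hsabs : |s| = 1 := by
    rcases mul_self_eq_one_iff.1 hs with h | h <;> simp [h]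
  have hn1 : ‖(Complex.I * (r : ℂ)) • e‖ = r * ‖e‖ := by
    rw [norm_smul]
    simp [abs_of_nonneg (zero_le_one.trans hr1)]
  have hn2 : ‖(s : ℂ) • laxOp u t x e‖ = r * ‖e‖ := by
    rw [norm_smul, norm_laxOp]
    simp [hsabs, r]
  rw [hcross, hn1, hn2] at hnorm
  refine le_of_sq_le_sq ?_ (by positivity)
  rw [hnorm]
  have h1 : r * (r - 1) ≤ ‖ux u x t‖ ^ 2 := by nlinarith
  nlinarith [mul_le_mul_of_nonneg_right h1 (sq_nonneg ‖e‖), mul_nonneg (sq_nonneg ‖ux u x t‖)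
    (sq_nonneg ‖e‖)]

/-- `ψ` solves the scattering problem `Φ_x = X Φ` at time `t`. -/
def SolvesX (u : VField) (t : ℝ) (k : ℂ) (ψ : ℝ → Mat42) : Prop :=
  ∀ x, HasMatDerivAt ψ (laxX u x t k * ψ x) x

/-- The normalization of the Jost solutions: `e^{iστθ} ψ → E` as `σ x → -∞`. -/
def HasJostLimit (u : VField) (σ τ t : ℝ) (k : ℂ) (E : Mat42) (ψ : ℝ → Mat42) : Prop :=
  Tendsto (fun x => Complex.exp ((σ * τ : ℝ) * (Complex.I * theta u (σ * x) t k)) • ψ (σ * x))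
    atBot (𝓝 E)

theorem SolvesX.solvesODE {t : ℝ} {k : ℂ} {ψ : ℝ → Mat42} (h : SolvesX u t k ψ) {σ τ : ℝ}
    (hτ : τ * τ = 1) (v : Fin 2 → ℂ) :
    SolvesODE (fun x => ((σ * τ : ℝ) : ℂ) • laxOp u t (σ * x)) (τ * k)
      (fun x => WithLp.toLp 2 (ψ (σ * x) *ᵥ v)) := by
  have h1 : ∀ x, HasDerivAt (fun y => ψ y *ᵥ v) ((laxX u x t k * ψ x) *ᵥ v) x := fun x => by
    refine hasDerivAt_pi.2 fun i => ?_
    simp only [mulVec, dotProduct]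
    exact HasDerivAt.fun_sum fun j _ => (h x i j).mul_const (v j)
  intro x
  have h2 := (h1 (σ * x)).scomp x ((hasDerivAt_id x).const_mul σ)
  have h3 := ((PiLp.continuousLinearEquiv 2 ℝ fun _ : Fin 2 ⊕ Fin 2 => ℂ).symm
    |>.toContinuousLinearMap.hasFDerivAt.comp_hasDerivAt x h2)
  refine h3.congr_deriv ?_
  have hτ' : (τ : ℂ) * τ = 1 := by exact_mod_cast hτ
  have h4 : (τ * k : ℂ) * (σ * τ) = σ * k := by linear_combination k * σ * hτ'
  simp only [_root_.smul_apply, laxOp_toLp, smul_smul]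
  push_cast
  rw [h4]
  ext i
  simp [laxX_eq_smul u _ _ k, smul_mulVec, ← mulVec_mulVec, mul_assoc]

/-- The gauge uses only the part `k ξ` of `θ`; the remaining part `-t / (4k)` does not depend on `x`
and reappears as a constant phase in the limit. -/
theorem HasJostLimit.tendsto_gauge {σ τ t : ℝ} {k : ℂ} {E : Mat42} {ψ : ℝ → Mat42}
    (h : HasJostLimit u σ τ t k E ψ) (v : Fin 2 → ℂ) :
    Tendsto (gauge (fun x => σ * xi u (σ * x) t) (τ * k)
        (fun x => WithLp.toLp 2 (ψ (σ * x) *ᵥ v))) atBot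
      (𝓝 (Complex.exp (Complex.I * ((σ * τ : ℝ) * (t / (4 * k)))) • WithLp.toLp 2 (E *ᵥ v))) := by
  have hc : Continuous fun M : Mat42 => (WithLp.toLp 2 (M *ᵥ v) : EuclideanSpace ℂ (Fin 2 ⊕ Fin 2)) :=
    (PiLp.continuous_toLp 2 _).comp (continuous_id.matrix_mulVec continuous_const)
  refine (((hc.tendsto E).comp h).const_smul
    (Complex.exp (Complex.I * ((σ * τ : ℝ) * (t / (4 * k)))))).congr fun x => ?_
  simp only [gauge, theta, Function.comp_apply, smul_mulVec, WithLp.toLp_smul, smul_smul,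
    ← Complex.exp_add]
  congr 2
  push_cast
  ring

/-- A family of Jost solutions of the Lax pair, for `τ Im k ≥ 0`, with phase `e^{iστθ}`, normalized
as `σ x → -∞`. -/
structure IsJostFamily (u : VField) (σ τ : ℝ) (E : Mat42) (F : ℝ → ℝ → ℂ → Mat42) : Prop where
  sq_σ : σ * σ = 1
  sq_τ : τ * τ = 1
  normalization : IsNormalization (σ * τ) E
  lax : ∀ k : ℂ, 0 ≤ τ * k.im → k ≠ 0 → IsLaxSolution u k fun x t => F x t k
  limit : ∀ k : ℂ, 0 ≤ τ * k.im → k ≠ 0 → ∀ t, HasJostLimit u σ τ t k E fun x => F x t k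

namespace IsJostFamily

variable {σ τ : ℝ} {E : Mat42} {F : ℝ → ℝ → ℂ → Mat42}

theorem solvesX (hF : IsJostFamily u σ τ E F) {k : ℂ} (hk : 0 ≤ τ * k.im) (hk0 : k ≠ 0) (t : ℝ) :
    SolvesX u t k fun x => F x t k := fun x i j => (hF.lax k hk hk0 x t i j).1

theorem injective (hu : IsSolution u) (hd : Decays u) (hF : IsJostFamily u σ τ E F) {k : ℂ}
    (hk : 0 ≤ τ * k.im) (hk0 : k ≠ 0) (x t : ℝ) (v : Fin 2 → ℂ) (hv : F x t k *ᵥ v = 0) :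
    v = 0 := by
  by_contra hv0
  have hS := (skewSystem_laxOp hu hd t).twist hF.sq_σ hF.sq_τ
  refine hS.ne_zero_of_tendsto (k := τ * k) (by simpa using hk)
    ((hF.solvesX hk hk0 t).solvesODE hF.sq_τ v) ?_ ((hF.limit k hk hk0 t).tendsto_gauge v) (σ * x) ?_
  · rw [smul_ne_zero_iff]
    refine ⟨Complex.exp_ne_zero _, fun h => hv0 (hF.normalization.injective v ?_)⟩
    simpa using h
  · rw [← mul_assoc, hF.sq_σ, one_mul, hv]
    simp

theorem eq_of_limit (hu : IsSolution u) (hd : Decays u) (hF : IsJostFamily u σ τ E F) {k : ℂ}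
    (hk : 0 ≤ τ * k.im) (hk0 : k ≠ 0) (t : ℝ) {ψ : ℝ → Mat42} (hψ : SolvesX u t k ψ)
    (hl : HasJostLimit u σ τ t k E ψ) (x : ℝ) : ψ x = F x t k := by
  have hS := (skewSystem_laxOp hu hd t).twist hF.sq_σ hF.sq_τ
  ext i j
  have := hS.eq_of_tendsto (k := τ * k) (by simpa using hk)
    (hψ.solvesODE hF.sq_τ (Pi.single j 1)) ((hF.solvesX hk hk0 t).solvesODE hF.sq_τ (Pi.single j 1))
    (hl.tendsto_gauge _) ((hF.limit k hk hk0 t).tendsto_gauge _) (σ * x)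
  simp only [← mul_assoc, hF.sq_σ, one_mul, mulVec_single_one] at this
  exact congrFun (WithLp.toLp_injective 2 this) i

/-- Taken at `t = 0`, where the constant phase is trivial and the gauge limit does not depend on
`k`. The substitution `k ↦ τ k` moves the half plane to the upper one. -/
theorem regular (hu : IsSolution u) (hd : Decays u) (hF : IsJostFamily u σ τ E F) (x : ℝ)
    (i : Fin 2 ⊕ Fin 2) (j : Fin 2) :
    ContinuousOn (fun k => F x 0 k i j) {k : ℂ | 0 ≤ τ * k.im ∧ k ≠ 0} ∧
      DifferentiableOn ℂ (fun k => F x 0 k i j) {k : ℂ | 0 < τ * k.im} := by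
  have hS := (skewSystem_laxOp hu hd 0).twist hF.sq_σ hF.sq_τ
  have hττ : (τ : ℂ) * τ = 1 := by exact_mod_cast hF.sq_τ
  have hτ0 : (τ : ℂ) ≠ 0 := fun h => by simp [h] at hττ
  set e : EuclideanSpace ℂ (Fin 2 ⊕ Fin 2) := WithLp.toLp 2 (E *ᵥ Pi.single j 1)
  have hσabs : |σ| = 1 := by
    rcases mul_self_eq_one_iff.1 hF.sq_σ with h | h <;> simp [h]
  obtain ⟨γ, hγ, hγ0⟩ := exists_primitive_tendsto_zero
    (h := fun x => 2 * ‖e‖ * ‖ux u (σ * x) 0‖)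
    (by
      have := hu.continuous_ux 0
      fun_prop)
    (by
      refine MeasureTheory.Integrable.const_mul ?_ _
      exact ((hd.ux_integrable 0).norm).comp_mul_left' (R := σ) (by
        rintro rfl
        simp at hσabs))
  have hmem : ∀ k ∈ closedUpper, 0 ≤ τ * (τ * k : ℂ).im ∧ (τ * k : ℂ) ≠ 0 := by
    rintro k ⟨hk, hk0⟩
    refine ⟨?_, mul_ne_zero hτ0 hk0⟩
    rw [Complex.im_ofReal_mul, ← mul_assoc, hF.sq_τ, one_mul]
    exact hk
  have hττk : ∀ k : ℂ, (τ : ℂ) * (τ * k) = k := fun k => by rw [← mul_assoc, hττ, one_mul]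
  have hreg := hS.regular_of_tendsto
    (ψ := fun x k => WithLp.toLp 2 (F (σ * x) 0 (τ * k) *ᵥ Pi.single j 1)) (e := e)
    (fun k hk => by
      have h := (hF.solvesX (hmem k hk).1 (hmem k hk).2 0).solvesODE (σ := σ) hF.sq_τ
        (Pi.single j 1)
      rwa [hττk] at h)
    (fun k hk => by
      have h := (hF.limit _ (hmem k hk).1 (hmem k hk).2 0).tendsto_gauge (Pi.single j 1)
      rw [hττk] at h
      simpa [e] using h)
    hγ hγ0
    (fun x => hF.normalization.norm_le (by linear_combination τ * τ * hF.sq_σ + hF.sq_τ) 0 (σ * x)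
      (Pi.single j 1))
    (σ * x)
  simp only [← mul_assoc, hF.sq_σ, one_mul, mulVec_single_one] at hreg
  have hproj : ∀ k, F x 0 k i j =
      (EuclideanSpace.proj i : EuclideanSpace ℂ (Fin 2 ⊕ Fin 2) →L[ℂ] ℂ)
        (WithLp.toLp 2 ((F x 0 (τ * (τ * k))).col j)) := fun k => by
    rw [hττk]
    rfl
  simp only [hproj]
  refine ⟨?_, ?_⟩
  · refine (EuclideanSpace.proj i).continuous.comp_continuousOn
      (hreg.1.comp (f := fun k => (τ : ℂ) * k) (by fun_prop) ?_)
    rintro k ⟨hk, hk0⟩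
    exact ⟨by simpa using hk, mul_ne_zero hτ0 hk0⟩
  · refine (EuclideanSpace.proj i).differentiable.comp_differentiableOn
      (hreg.2.comp (f := fun k => (τ : ℂ) * k)
        (differentiable_id.const_mul _).differentiableOn ?_)
    intro k hk
    simpa [openUpper] using hk

end IsJostFamily

end Families

end CCSPE

end

noncomputable section

namespace CCSPE

open Matrix Filter Topology

theorem map_star_mul {l m n : Type*} [Fintype m] (A : Matrix l m ℂ) (B : Matrix m n ℂ) :
    (A * B).map star = A.map star * B.map star := by
  ext i j
  simp [mul_apply]

/-! ### Constant sesquilinear Wronskians of Lax solutions. -/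

section Wronskian

variable {u : VField}

/-- Differentiating the product in `x` or `t` produces `X(k*)† + X(k)` or `T(k*)† + T(k)` in the
middle, and both vanish. -/
theorem IsLaxSolution.conjTranspose_mul_eq {k : ℂ} {Ψ₁ Ψ₂ : ℝ → ℝ → Mat42}
    (h₁ : IsLaxSolution u (star k) Ψ₁) (h₂ : IsLaxSolution u k Ψ₂) (x t x' t' : ℝ) :
    (Ψ₁ x t)ᴴ * Ψ₂ x t = (Ψ₁ x' t')ᴴ * Ψ₂ x' t' := by
  have hx : ∀ x, (Ψ₁ x t)ᴴ * Ψ₂ x t = (Ψ₁ x' t)ᴴ * Ψ₂ x' t := fun x => by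
    refine eq_of_hasMatDerivAt_zero (A := fun x => (Ψ₁ x t)ᴴ * Ψ₂ x t) (fun y => ?_) x x'
    have hA : HasMatDerivAt (fun y => Ψ₁ y t) (laxX u y t (star k) * Ψ₁ y t) y :=
      fun i j => (h₁ y t i j).1
    have hB : HasMatDerivAt (fun y => Ψ₂ y t) (laxX u y t k * Ψ₂ y t) y :=
      fun i j => (h₂ y t i j).1
    have h := hA.conjTranspose.mul hB
    rwa [conjTranspose_mul, conjTranspose_laxX, ← Matrix.mul_assoc, Matrix.mul_neg, Matrix.neg_mul,
      neg_add_cancel] at h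
  rw [hx x]
  refine eq_of_hasMatDerivAt_zero (A := fun s => (Ψ₁ x' s)ᴴ * Ψ₂ x' s) (fun s => ?_) t t'
  have hA : HasMatDerivAt (fun s => Ψ₁ x' s) (laxT u x' s (star k) * Ψ₁ x' s) s :=
    fun i j => (h₁ x' s i j).2
  have hB : HasMatDerivAt (fun s => Ψ₂ x' s) (laxT u x' s k * Ψ₂ x' s) s :=
    fun i j => (h₂ x' s i j).2
  have h := hA.conjTranspose.mul hB
  rwa [conjTranspose_mul, conjTranspose_laxT, ← Matrix.mul_assoc, Matrix.mul_neg, Matrix.neg_mul,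
    neg_add_cancel] at h

theorem star_theta (x t : ℝ) (k : ℂ) : star (theta u x t (star k)) = theta u x t k := by
  simp [theta]

namespace IsJostFamily

variable {σ τ₁ τ₂ : ℝ} {E₁ E₂ : Mat42} {F₁ F₂ : ℝ → ℝ → ℂ → Mat42}

theorem exists_wronskian_tendsto (h₁ : IsJostFamily u σ τ₁ E₁ F₁) (h₂ : IsJostFamily u σ τ₂ E₂ F₂)
    {k : ℂ} (hk₁ : 0 ≤ τ₁ * (star k).im) (hk₂ : 0 ≤ τ₂ * k.im) (hk0 : k ≠ 0) :
    Tendsto (fun x => Complex.exp ((σ * τ₂ - σ * τ₁ : ℝ) * (Complex.I * theta u (σ * x) 0 k)) •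
      ((F₁ 0 0 (star k))ᴴ * F₂ 0 0 k)) atBot (𝓝 (E₁ᴴ * E₂)) := by
  have hk0' : star k ≠ 0 := star_ne_zero.2 hk0
  have l₁ := h₁.limit (star k) hk₁ hk0' 0
  have l₂ := h₂.limit k hk₂ hk0 0
  have hc : Continuous fun p : Mat42 × Mat42 => p.1ᴴ * p.2 :=
    (continuous_fst.matrix_conjTranspose).matrix_mul continuous_snd
  refine ((hc.tendsto (E₁, E₂)).comp (l₁.prodMk_nhds l₂)).congr fun x => ?_
  simp only [Function.comp_apply, conjTranspose_smul, Matrix.smul_mul, Matrix.mul_smul, smul_smul]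
  rw [(h₁.lax (star k) hk₁ hk0').conjTranspose_mul_eq (h₂.lax k hk₂ hk0) (σ * x) 0 0 0]
  congr 1
  have : star (Complex.exp ((σ * τ₁ : ℝ) * (Complex.I * theta u (σ * x) 0 (star k)))) =
      Complex.exp (-((σ * τ₁ : ℝ) * (Complex.I * theta u (σ * x) 0 k))) := by
    rw [← star_theta (u := u) (σ * x) 0 k, Complex.star_def, ← Complex.exp_conj]
    simp
  rw [this, ← Complex.exp_add]
  congr 1
  push_cast
  ring

theorem wronskian_eq (h₁ : IsJostFamily u σ τ₁ E₁ F₁) (h₂ : IsJostFamily u σ τ₁ E₂ F₂)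
    {k : ℂ} (hk : k.im = 0) (hk0 : k ≠ 0) (x t : ℝ) :
    (F₁ x t (star k))ᴴ * F₂ x t k = E₁ᴴ * E₂ := by
  have hk₁ : 0 ≤ τ₁ * (star k).im := by simp [hk]
  have hk₂ : 0 ≤ τ₁ * k.im := by simp [hk]
  rw [(h₁.lax (star k) hk₁ (star_ne_zero.2 hk0)).conjTranspose_mul_eq (h₂.lax k hk₂ hk0) x t 0 0]
  have h := exists_wronskian_tendsto h₁ h₂ hk₁ hk₂ hk0
  simp only [sub_self, Complex.ofReal_zero, zero_mul, Complex.exp_zero, one_smul] at h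
  exact tendsto_nhds_unique tendsto_const_nhds h

/-- For opposite `τ` at the same end the phases add up: `e^{2iστ₂θ} W → 0` with `W` constant. The
exponential stays bounded away from `0` because `σ ξ(σx)` is monotone and `τ₂ Im k ≥ 0`, so `W = 0`,
real `k` included. -/
theorem wronskian_eq_zero (hu : IsSolution u) (hd : Decays u) (h₁ : IsJostFamily u σ (-τ₂) E₁ F₁)
    (h₂ : IsJostFamily u σ τ₂ E₂ F₂) (hE : E₁ᴴ * E₂ = 0) {k : ℂ} (hk : 0 ≤ τ₂ * k.im)
    (hk0 : k ≠ 0) (x t : ℝ) : (F₁ x t (star k))ᴴ * F₂ x t k = 0 := by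
  have hk₁ : 0 ≤ -τ₂ * (star k).im := by simpa using hk
  rw [(h₁.lax (star k) hk₁ (star_ne_zero.2 hk0)).conjTranspose_mul_eq (h₂.lax k hk hk0) x t 0 0]
  set W := (F₁ 0 0 (star k))ᴴ * F₂ 0 0 k
  have h := exists_wronskian_tendsto h₁ h₂ hk₁ hk hk0
  rw [hE] at h
  set c : ℝ → ℂ := fun x =>
    Complex.exp (((σ * τ₂ - σ * -τ₂ : ℝ) : ℂ) * (Complex.I * theta u (σ * x) 0 k)) with hc
  have hS := (skewSystem_laxOp hu hd 0).twist h₁.sq_σ h₂.sq_τ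
  have hmono : Monotone fun x => σ * xi u (σ * x) 0 :=
    monotone_of_deriv_nonneg (fun y => (hS.phase y).differentiableAt) fun y => by
      rw [(hS.phase y).deriv]
      positivity
  have hbound : ∀ᶠ x in atBot, ‖(c x)⁻¹‖ ≤
      Real.exp (2 * (τ₂ * k.im) * (σ * xi u (σ * 0) 0)) := by
    filter_upwards [eventually_le_atBot 0] with x hx
    rw [hc, norm_inv, Complex.norm_exp, ← Real.exp_neg, Real.exp_le_exp]
    have : -(((σ * τ₂ - σ * -τ₂ : ℝ) : ℂ) * (Complex.I * theta u (σ * x) 0 k)).re =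
        2 * (τ₂ * k.im) * (σ * xi u (σ * x) 0) := by
      rw [Complex.re_ofReal_mul]
      simp [theta]
      ring
    rw [this]
    exact mul_le_mul_of_nonneg_left (hmono hx) (by positivity)
  ext i j
  have hij : Tendsto (fun x => c x * W i j) atBot (𝓝 0) := by
    have := (tendsto_pi_nhds.1 ((tendsto_pi_nhds.1 h) i)) j
    simpa [c, W] using this
  have h0 := hij.zero_mul_isBoundedUnder_le
    (g := fun x => (c x)⁻¹) ⟨_, eventually_map.2 hbound⟩
  refine tendsto_nhds_unique tendsto_const_nhds (h0.congr fun x => ?_)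
  rw [mul_comm (c x), mul_assoc, mul_inv_cancel₀ (Complex.exp_ne_zero _), mul_one]

end IsJostFamily

end Wronskian

/-! ### The symmetry `k ↦ -k*`. -/

section Symmetry

variable {u : VField} {σ τ : ℝ} {E : Mat42} {F : ℝ → ℝ → ℂ → Mat42}

/-- The transformed family solves the same `x`-equation with the same normalization, so uniqueness
identifies the two. -/
theorem IsJostFamily.symp_symmetry (hu : IsSolution u) (hd : Decays u)
    (hF : IsJostFamily u σ τ E F) (hE : (symp₄ * E * sympᵀ).map star = E) {k : ℂ}
    (hk : 0 ≤ τ * k.im) (hk0 : k ≠ 0) (x t : ℝ) :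
    symp₄ * F x t (-star k) * sympᵀ = (F x t k).map star := by
  have hk' : 0 ≤ τ * (-star k).im := by simpa using hk
  have hk0' : -star k ≠ 0 := neg_ne_zero.2 (star_ne_zero.2 hk0)
  have hinv : ∀ A : Mat42, (A.map star).map star = A := fun A => by ext i j; simp
  have hinv₄ : ∀ A : Mat4, (A.map star).map star = A := fun A => by ext i j; simp
  have hsol : SolvesX u t k fun x => (symp₄ * F x t (-star k) * sympᵀ).map star := by
    intro y
    have h := (((hasMatDerivAt_const symp₄ y).mul (hF.solvesX hk' hk0' t y)).mul
      (hasMatDerivAt_const sympᵀ y)).map_star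
    rwa [Matrix.zero_mul, zero_add, Matrix.mul_zero, add_zero, ← Matrix.mul_assoc, symp₄_mul_laxX,
      Matrix.mul_assoc _ symp₄, Matrix.mul_assoc _ (symp₄ * _), map_star_mul, hinv₄] at h
  have hlim : HasJostLimit u σ τ t k E fun x => (symp₄ * F x t (-star k) * sympᵀ).map star := by
    have hc : Continuous fun M : Mat42 => (symp₄ * M * sympᵀ).map star :=
      ((continuous_const.matrix_mul continuous_id).matrix_mul continuous_const).matrix_map
        continuous_star
    have h := (hc.tendsto E).comp (hF.limit (-star k) hk' hk0' t)
    rw [hE] at h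
    refine h.congr fun y => ?_
    have hexp : star (Complex.exp ((σ * τ : ℝ) * (Complex.I * theta u (σ * y) t (-star k)))) =
        Complex.exp ((σ * τ : ℝ) * (Complex.I * theta u (σ * y) t k)) := by
      rw [Complex.star_def, ← Complex.exp_conj]
      congr 1
      simp [theta, map_ofNat]
      ring
    rw [← hexp]
    ext i j
    simp only [Function.comp_apply, Matrix.mul_smul, Matrix.smul_mul, map_apply, Matrix.smul_apply,
      smul_eq_mul, star_mul']
  rw [← hF.eq_of_limit hu hd hk hk0 t hsol hlim x, hinv]

theorem IsNormalization.symp_fst :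
    (symp₄ * fromRows (1 : Mat2) (0 : Mat2) * sympᵀ).map star = fromRows (1 : Mat2) (0 : Mat2) := by
  rw [symp₄, fromBlocks_mul_fromRows, fromRows_mul]
  simp only [Matrix.mul_one, Matrix.mul_zero, add_zero, Matrix.zero_mul, symp_mul_transpose]
  ext (i | i) j <;> simp [Matrix.one_apply, apply_ite]

theorem rank_conjTranspose_mul_of_symp {M₁ M₂ N₁ N₂ : Mat42}
    (h₁ : symp₄ * N₁ * sympᵀ = M₁.map star) (h₂ : symp₄ * N₂ * sympᵀ = M₂.map star) :
    (N₁ᴴ * N₂).rank = (M₁ᴴ * M₂).rank := by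
  have hs : (sympᵀ)ᴴ = symp := symp_map_star
  have hs₄ : symp₄ᴴ = symp₄ᵀ := by
    rw [conjTranspose, transpose_map, symp₄_map_star]
  have h : symp * (N₁ᴴ * N₂) * sympᵀ = (M₁ᴴ * M₂).map star := by
    have h3 : (M₁ᴴ * M₂).map star = (M₁.map star)ᴴ * M₂.map star := by
      rw [map_star_mul]
      rfl
    rw [h3, ← h₁, ← h₂, conjTranspose_mul, conjTranspose_mul, hs, hs₄]
    have : N₁ᴴ * N₂ = N₁ᴴ * (symp₄ᵀ * symp₄) * N₂ := by rw [transpose_mul_symp₄, Matrix.mul_one]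
    rw [this]
    simp only [Matrix.mul_assoc]
  have hdet : IsUnit symp.det := (isUnit_iff_isUnit_det _).1
    (IsUnit.of_mul_eq_one _ symp_mul_transpose)
  rw [← rank_map_star (M₁ᴴ * M₂), ← h, rank_mul_eq_left_of_isUnit_det _ _ (by rwa [det_transpose]),
    rank_mul_eq_right_of_isUnit_det _ _ hdet]

end Symmetry

/-! ### Scattering data and the rank formulas. -/

namespace JostEigenfunctions

variable {u : VField} (Φ : JostEigenfunctions u)

/-- In the four instances `σ = 1` means normalization at `-∞` and `σ = -1` at `+∞`, `τ` is the sign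
of the half plane, and `σ τ` is the sign of the phase. -/
theorem isJostFamily_minus₁ : IsJostFamily u 1 1 (fromRows (1 : Mat2) (0 : Mat2)) Φ.minus₁ where
  sq_σ := by norm_num
  sq_τ := by norm_num
  normalization := by simpa using isNormalization_fst
  lax k hk hk0 := Φ.minus₁_lax k (by simpa using hk) hk0
  limit k hk hk0 t := by
    simpa [HasJostLimit] using Φ.minus₁_tendsto k (by simpa using hk) hk0 t

theorem isJostFamily_minus₂ : IsJostFamily u 1 (-1) (fromRows (0 : Mat2) (1 : Mat2)) Φ.minus₂ where
  sq_σ := by norm_num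
  sq_τ := by norm_num
  normalization := by simpa using isNormalization_snd
  lax k hk hk0 := Φ.minus₂_lax k (by simpa using hk) hk0
  limit k hk hk0 t := by
    simpa [HasJostLimit] using Φ.minus₂_tendsto k (by simpa using hk) hk0 t

theorem isJostFamily_plus₁ :
    IsJostFamily u (-1) (-1) (fromRows (1 : Mat2) (0 : Mat2)) Φ.plus₁ where
  sq_σ := by norm_num
  sq_τ := by norm_num
  normalization := by simpa using isNormalization_fst
  lax k hk hk0 := Φ.plus₁_lax k (by simpa using hk) hk0
  limit k hk hk0 t := by
    simpa [HasJostLimit, Function.comp_def] using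
      (Φ.plus₁_tendsto k (by simpa using hk) hk0 t).comp tendsto_neg_atBot_atTop

theorem isJostFamily_plus₂ :
    IsJostFamily u (-1) 1 (fromRows (0 : Mat2) (1 : Mat2)) Φ.plus₂ where
  sq_σ := by norm_num
  sq_τ := by norm_num
  normalization := by simpa using isNormalization_snd
  lax k hk hk0 := Φ.plus₂_lax k (by simpa using hk) hk0
  limit k hk hk0 t := by
    simpa [HasJostLimit, Function.comp_def] using
      (Φ.plus₂_tendsto k (by simpa using hk) hk0 t).comp tendsto_neg_atBot_atTop

/-- `Φ₊₁†(k*) Φ₋₁(k)`, which is `a(k)`. -/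
def aWronskian (k : ℂ) : Mat2 := (Φ.plus₁ 0 0 (star k))ᴴ * Φ.minus₁ 0 0 k

/-- `Φ₊₂†(k*) Φ₋₂(k)`, which is `ā(k)`. -/
def abarWronskian (k : ℂ) : Mat2 := (Φ.plus₂ 0 0 (star k))ᴴ * Φ.minus₂ 0 0 k

theorem aWronskian_eq {k : ℂ} (hk : 0 ≤ k.im) (hk0 : k ≠ 0) (x t : ℝ) :
    (Φ.plus₁ x t (star k))ᴴ * Φ.minus₁ x t k = Φ.aWronskian k :=
  (Φ.plus₁_lax (star k) (by simpa using hk) (star_ne_zero.2 hk0)).conjTranspose_mul_eq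
    (Φ.minus₁_lax k hk hk0) x t 0 0

theorem abarWronskian_eq {k : ℂ} (hk : k.im ≤ 0) (hk0 : k ≠ 0) (x t : ℝ) :
    (Φ.plus₂ x t (star k))ᴴ * Φ.minus₂ x t k = Φ.abarWronskian k :=
  (Φ.plus₂_lax (star k) (by simpa using hk) (star_ne_zero.2 hk0)).conjTranspose_mul_eq
    (Φ.minus₂_lax k hk hk0) x t 0 0

theorem fst_conjTranspose_mul_snd :
    (fromRows (1 : Mat2) (0 : Mat2))ᴴ * fromRows (0 : Mat2) (1 : Mat2) = 0 := by
  rw [conjTranspose_fromRows_eq_fromCols_conjTranspose, fromCols_mul_fromRows]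
  simp

theorem snd_conjTranspose_mul_fst :
    (fromRows (0 : Mat2) (1 : Mat2))ᴴ * fromRows (1 : Mat2) (0 : Mat2) = 0 := by
  rw [conjTranspose_fromRows_eq_fromCols_conjTranspose, fromCols_mul_fromRows]
  simp

variable {Φ} in
theorem plus₁_mul_plus₂ (hu : IsSolution u) (hd : Decays u) {k : ℂ} (hk : 0 ≤ k.im) (hk0 : k ≠ 0)
    (x t : ℝ) : (Φ.plus₁ x t (star k))ᴴ * Φ.plus₂ x t k = 0 :=
  Φ.isJostFamily_plus₁.wronskian_eq_zero hu hd Φ.isJostFamily_plus₂ fst_conjTranspose_mul_snd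
    (by simpa using hk) hk0 x t

variable {Φ} in
theorem minus₂_mul_minus₁ (hu : IsSolution u) (hd : Decays u) {k : ℂ} (hk : 0 ≤ k.im) (hk0 : k ≠ 0)
    (x t : ℝ) : (Φ.minus₂ x t (star k))ᴴ * Φ.minus₁ x t k = 0 :=
  Φ.isJostFamily_minus₂.wronskian_eq_zero hu hd Φ.isJostFamily_minus₁ snd_conjTranspose_mul_fst
    (by simpa using hk) hk0 x t

theorem conjTranspose_plus_mul_plus (hu : IsSolution u) (hd : Decays u) {k : ℝ} (hk : k ≠ 0)
    (x t : ℝ) : (Φ.plus x t k)ᴴ * Φ.plus x t k = 1 := by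
  have hk0 : (k : ℂ) ≠ 0 := Complex.ofReal_ne_zero.2 hk
  have hs : star (k : ℂ) = k := Complex.conj_ofReal k
  have h11 := Φ.isJostFamily_plus₁.wronskian_eq Φ.isJostFamily_plus₁ (Complex.ofReal_im k) hk0 x t
  have h22 := Φ.isJostFamily_plus₂.wronskian_eq Φ.isJostFamily_plus₂ (Complex.ofReal_im k) hk0 x t
  have h12 := plus₁_mul_plus₂ (Φ := Φ) hu hd (Complex.ofReal_im k).ge hk0 x t
  rw [hs] at h11 h22 h12
  have h21 : (Φ.plus₂ x t k)ᴴ * Φ.plus₁ x t k = 0 := by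
    have := congrArg conjTranspose h12
    simpa using this
  rw [plus, conjTranspose_fromCols_eq_fromRows_conjTranspose, fromRows_mul_fromCols, h11, h22, h12,
    h21, conjTranspose_fromRows_eq_fromCols_conjTranspose,
    conjTranspose_fromRows_eq_fromCols_conjTranspose, fromCols_mul_fromRows, fromCols_mul_fromRows]
  simp

/-- `Φ₊` is unitary for real `k`, so `Φ₊⁻¹ Φ₋ = Φ₊† Φ₋`, whose blocks are Wronskians and hence
constant. -/
theorem isScatteringMatrix_wronskian (hu : IsSolution u) (hd : Decays u) :
    Φ.IsScatteringMatrix fun k => (Φ.plus 0 0 k)ᴴ * Φ.minus 0 0 k := by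
  intro k hk x t
  have hk0 : (k : ℂ) ≠ 0 := Complex.ofReal_ne_zero.2 hk
  have hs : star (k : ℂ) = k := Complex.conj_ofReal k
  have him := Complex.ofReal_im k
  have hconst : (Φ.plus 0 0 k)ᴴ * Φ.minus 0 0 k = (Φ.plus x t k)ᴴ * Φ.minus x t k := by
    have p1 := Φ.plus₁_lax k him.le hk0
    have p2 := Φ.plus₂_lax k him.ge hk0
    rw [← hs] at p1 p2
    have m1 := Φ.minus₁_lax k him.ge hk0
    have m2 := Φ.minus₂_lax k him.le hk0
    have h11 := p1.conjTranspose_mul_eq m1 0 0 x t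
    have h12 := p1.conjTranspose_mul_eq m2 0 0 x t
    have h21 := p2.conjTranspose_mul_eq m1 0 0 x t
    have h22 := p2.conjTranspose_mul_eq m2 0 0 x t
    simp only [hs] at h11 h12 h21 h22
    simp only [plus, minus, conjTranspose_fromCols_eq_fromRows_conjTranspose,
      fromRows_mul_fromCols, h11, h12, h21, h22]
  simp only [hconst]
  rw [← Matrix.mul_assoc, mul_eq_one_comm.1 (Φ.conjTranspose_plus_mul_plus hu hd hk x t),
    Matrix.one_mul]

theorem isScatteringMatrix_scattering (hu : IsSolution u) (hd : Decays u) :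
    Φ.IsScatteringMatrix Φ.scattering :=
  Classical.epsilon_spec ⟨_, Φ.isScatteringMatrix_wronskian hu hd⟩

theorem scattering_eq (hu : IsSolution u) (hd : Decays u) {k : ℝ} (hk : k ≠ 0) :
    Φ.scattering k = fromBlocks (Φ.aWronskian k) ((Φ.plus₁ 0 0 k)ᴴ * Φ.minus₂ 0 0 k)
      ((Φ.plus₂ 0 0 k)ᴴ * Φ.minus₁ 0 0 k) (Φ.abarWronskian k) := by
  have hs : star (k : ℂ) = k := Complex.conj_ofReal k
  have h := congrArg ((Φ.plus 0 0 k)ᴴ * ·) (Φ.isScatteringMatrix_scattering hu hd k hk 0 0)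
  simp only [← Matrix.mul_assoc] at h
  rw [Φ.conjTranspose_plus_mul_plus hu hd hk, Matrix.one_mul] at h
  rw [← h, plus, minus, conjTranspose_fromCols_eq_fromRows_conjTranspose, fromRows_mul_fromCols,
    aWronskian, abarWronskian, hs]

theorem wronskian_regular (hu : IsSolution u) (hd : Decays u) {σ₁ σ₂ τ : ℝ} {E₁ E₂ : Mat42}
    {F₁ F₂ : ℝ → ℝ → ℂ → Mat42} (h₁ : IsJostFamily u σ₁ (-τ) E₁ F₁)
    (h₂ : IsJostFamily u σ₂ τ E₂ F₂) (i j : Fin 2) :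
    ContinuousOn (fun k => ((F₁ 0 0 (star k))ᴴ * F₂ 0 0 k) i j) {k : ℂ | 0 ≤ τ * k.im ∧ k ≠ 0} ∧
      DifferentiableOn ℂ (fun k => ((F₁ 0 0 (star k))ᴴ * F₂ 0 0 k) i j)
        {k : ℂ | 0 < τ * k.im} := by
  simp only [mul_apply, conjTranspose_apply]
  refine ⟨continuousOn_finsetSum _ fun l _ => ?_, DifferentiableOn.fun_sum fun l _ => ?_⟩
  · refine ContinuousOn.mul ?_ (h₂.regular hu hd 0 l j).1
    refine continuous_star.comp_continuousOn
      ((h₁.regular hu hd 0 l i).1.comp continuous_star.continuousOn ?_)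
    rintro k ⟨hk, hk0⟩
    exact ⟨by simpa using hk, star_ne_zero.2 hk0⟩
  · refine DifferentiableOn.mul ?_ (h₂.regular hu hd 0 l j).2
    intro k hk
    have ho : IsOpen {k : ℂ | 0 < -τ * k.im} :=
      isOpen_lt continuous_const (continuous_const.mul Complex.continuous_im)
    have hk' : star k ∈ {k : ℂ | 0 < -τ * k.im} := by simpa using hk
    -- Schwarz reflection: `k ↦ conj (f (conj k))` is analytic where `f` is analytic at `conj k`.
    have h := ((h₁.regular hu hd 0 l i).2.differentiableAt (ho.mem_nhds hk')).star_star
    rw [star_star] at h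
    exact h.differentiableWithinAt

theorem isUpperExtension_aWronskian (hu : IsSolution u) (hd : Decays u) :
    IsUpperExtension (fun k => (Φ.scattering k).toBlocks₁₁) Φ.aWronskian where
  analytic i j := by
    simpa [aWronskian] using (wronskian_regular hu hd Φ.isJostFamily_plus₁ Φ.isJostFamily_minus₁ i j).2
  continuousOn := by
    refine continuousOn_pi.2 fun i => continuousOn_pi.2 fun j => ?_
    simpa [aWronskian] using (wronskian_regular hu hd Φ.isJostFamily_plus₁ Φ.isJostFamily_minus₁ i j).1
  boundary k hk := by rw [Φ.scattering_eq hu hd hk, toBlocks_fromBlocks₁₁]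

theorem isLowerExtension_abarWronskian (hu : IsSolution u) (hd : Decays u) :
    IsLowerExtension (fun k => (Φ.scattering k).toBlocks₂₂) Φ.abarWronskian where
  analytic i j := by
    have h : IsJostFamily u (-1) (-(-1)) (fromRows (0 : Mat2) (1 : Mat2)) Φ.plus₂ := by
      simpa using Φ.isJostFamily_plus₂
    simpa [abarWronskian] using (wronskian_regular hu hd h Φ.isJostFamily_minus₂ i j).2
  continuousOn := by
    have h : IsJostFamily u (-1) (-(-1)) (fromRows (0 : Mat2) (1 : Mat2)) Φ.plus₂ := by
      simpa using Φ.isJostFamily_plus₂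
    refine continuousOn_pi.2 fun i => continuousOn_pi.2 fun j => ?_
    simpa [abarWronskian] using (wronskian_regular hu hd h Φ.isJostFamily_minus₂ i j).1
  boundary k hk := by rw [Φ.scattering_eq hu hd hk, toBlocks_fromBlocks₂₂]

theorem isUpperExtension_a (hu : IsSolution u) (hd : Decays u) :
    IsUpperExtension (fun k => (Φ.scattering k).toBlocks₁₁) Φ.a :=
  Classical.epsilon_spec ⟨_, Φ.isUpperExtension_aWronskian hu hd⟩

theorem isLowerExtension_abar (hu : IsSolution u) (hd : Decays u) :
    IsLowerExtension (fun k => (Φ.scattering k).toBlocks₂₂) Φ.abar :=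
  Classical.epsilon_spec ⟨_, Φ.isLowerExtension_abarWronskian hu hd⟩

theorem a_eq (hu : IsSolution u) (hd : Decays u) {k : ℂ} (hk : 0 < k.im) :
    Φ.a k = Φ.aWronskian k :=
  (Φ.isUpperExtension_a hu hd).eq_of_im_pos (Φ.isUpperExtension_aWronskian hu hd) hk

theorem abar_eq (hu : IsSolution u) (hd : Decays u) {k : ℂ} (hk : k.im < 0) :
    Φ.abar k = Φ.abarWronskian k :=
  (Φ.isLowerExtension_abar hu hd).eq_of_im_neg (Φ.isLowerExtension_abarWronskian hu hd) hk

theorem ne_zero_of_im_pos {k : ℂ} (hk : 0 < k.im) : k ≠ 0 := fun h => by simp [h] at hk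

/-- `A(k) = diag(a(k), ā(k*)†)`. -/
theorem A_eq (hu : IsSolution u) (hd : Decays u) {k : ℂ} (hk : 0 < k.im) (x t : ℝ) :
    Φ.A x t k = fromBlocks (Φ.a k) 0 0 (Φ.abar (star k))ᴴ := by
  have hk0 := ne_zero_of_im_pos hk
  have hk' : (star k).im < 0 := by simpa using hk
  have h := Φ.abarWronskian_eq hk'.le (star_ne_zero.2 hk0) x t
  rw [star_star] at h
  rw [A, P, Pbar, conjTranspose_fromCols_eq_fromRows_conjTranspose, fromRows_mul_fromCols,
    Φ.aWronskian_eq hk.le hk0, plus₁_mul_plus₂ hu hd hk.le hk0, minus₂_mul_minus₁ hu hd hk.le hk0,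
    Φ.a_eq hu hd hk, Φ.abar_eq hu hd hk', ← h, conjTranspose_mul, conjTranspose_conjTranspose]

theorem rank_P_eq (hu : IsSolution u) (hd : Decays u) {k : ℂ} (hk : 0 < k.im) (x t : ℝ) :
    (Φ.P x t k).rank = 2 + (Φ.a k).rank := by
  have hk0 := ne_zero_of_im_pos hk
  rw [P, rank_fromCols_eq (M' := Φ.plus₁ x t (star k)), Φ.aWronskian_eq hk.le hk0,
    Φ.a_eq hu hd hk]
  · exact Φ.isJostFamily_plus₂.injective hu hd (by simpa using hk.le) hk0 x t
  · exact Φ.isJostFamily_plus₁.injective hu hd (by simpa using hk.le) (star_ne_zero.2 hk0) x t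
  · exact plus₁_mul_plus₂ hu hd hk.le hk0 x t

/-- The same matrix `P`, now with `Φ₋₁` eliminated by means of `Φ₋₂†(k*)`. Comparing with
`rank_P_eq` links `a(k)` and `ā(k*)` without a determinant identity. -/
theorem rank_P_eq' (hu : IsSolution u) (hd : Decays u) {k : ℂ} (hk : 0 < k.im) (x t : ℝ) :
    (Φ.P x t k).rank = 2 + (Φ.abar (star k)).rank := by
  have hk0 := ne_zero_of_im_pos hk
  have hk' : (star k).im < 0 := by simpa using hk
  have h := Φ.abarWronskian_eq hk'.le (star_ne_zero.2 hk0) x t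
  rw [star_star] at h
  have h2 : (Φ.minus₂ x t (star k))ᴴ * Φ.plus₂ x t k = (Φ.abar (star k))ᴴ := by
    rw [Φ.abar_eq hu hd hk', ← h, conjTranspose_mul, conjTranspose_conjTranspose]
  rw [P, rank_fromCols_comm, rank_fromCols_eq (M' := Φ.minus₂ x t (star k)), h2]
  · open scoped ComplexOrder in rw [rank_conjTranspose]
  · exact Φ.isJostFamily_minus₁.injective hu hd (by simpa using hk.le) hk0 x t
  · exact Φ.isJostFamily_minus₂.injective hu hd (by simpa using hk.le) (star_ne_zero.2 hk0) x t
  · exact minus₂_mul_minus₁ hu hd hk.le hk0 x t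

theorem rank_Pbar_eq (hu : IsSolution u) (hd : Decays u) {k : ℂ} (hk : 0 < k.im) (x t : ℝ) :
    (Φ.Pbar x t (star k)).rank = 2 + (Φ.a k).rank := by
  have hk0 := ne_zero_of_im_pos hk
  have h2 : (Φ.minus₁ x t k)ᴴ * Φ.plus₁ x t (star k) = (Φ.a k)ᴴ := by
    rw [Φ.a_eq hu hd hk, ← Φ.aWronskian_eq hk.le hk0 x t, conjTranspose_mul,
      conjTranspose_conjTranspose]
  rw [Pbar, rank_fromCols_eq (M' := Φ.minus₁ x t k), h2]
  · open scoped ComplexOrder in rw [rank_conjTranspose]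
  · exact Φ.isJostFamily_minus₂.injective hu hd (by simpa using hk.le) (star_ne_zero.2 hk0) x t
  · exact Φ.isJostFamily_minus₁.injective hu hd (by simpa using hk.le) hk0 x t
  · have := congrArg conjTranspose (minus₂_mul_minus₁ (Φ := Φ) hu hd hk.le hk0 x t)
    simpa using this

theorem rank_abar_star (hu : IsSolution u) (hd : Decays u) {k : ℂ} (hk : 0 < k.im) :
    (Φ.abar (star k)).rank = (Φ.a k).rank := by
  have h1 := Φ.rank_P_eq hu hd hk 0 0
  have h2 := Φ.rank_P_eq' hu hd hk 0 0
  omega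

theorem rank_a_neg_star (hu : IsSolution u) (hd : Decays u) {k : ℂ} (hk : 0 < k.im) :
    (Φ.a (-star k)).rank = (Φ.a k).rank := by
  have hk0 := ne_zero_of_im_pos hk
  rw [Φ.a_eq hu hd hk, Φ.a_eq hu hd (by simpa using hk), aWronskian, aWronskian]
  refine rank_conjTranspose_mul_of_symp ?_ ?_
  · rw [star_neg]
    exact Φ.isJostFamily_plus₁.symp_symmetry hu hd IsNormalization.symp_fst
      (by simpa using hk.le) (star_ne_zero.2 hk0) 0 0
  · exact Φ.isJostFamily_minus₁.symp_symmetry hu hd IsNormalization.symp_fst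
      (by simpa using hk.le) hk0 0 0

theorem tfae_rank (hu : IsSolution u) (hd : Decays u) {k : ℂ} (hk : 0 < k.im) (x t : ℝ) :
    List.TFAE [
      (Φ.P x t k).rank = 2 ∧ (Φ.Pbar x t (star k)).rank = 2,
      Φ.a k = 0 ∧ Φ.abar (star k) = 0,
      (Φ.A x t k).rank = 0,
      (Φ.P x t k).rank = 2,
      (Φ.Pbar x t (star k)).rank = 2] := by
  have h1 := Φ.rank_P_eq hu hd hk x t
  have h2 := Φ.rank_Pbar_eq hu hd hk x t
  have h3 := Φ.rank_abar_star hu hd hk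
  have h4 := rank_eq_zero_iff' (Φ.a k)
  have h5 := rank_eq_zero_iff' (Φ.abar (star k))
  have h6 : (Φ.A x t k).rank = 0 ↔ Φ.a k = 0 ∧ Φ.abar (star k) = 0 := by
    rw [rank_eq_zero_iff', Φ.A_eq hu hd hk, ← fromBlocks_zero, fromBlocks_inj]
    simp
  rw [h6, ← h4, ← h5, h1, h2, h3]
  tfae_have 1 ↔ 2 := by omega
  tfae_have 2 ↔ 3 := by omega
  tfae_have 2 ↔ 4 := by omega
  tfae_have 2 ↔ 5 := by omega
  tfae_finish

end JostEigenfunctions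

end CCSPE

end

theorem mainTheorem9 (u : CCSPE.VField) (hu : CCSPE.IsSolution u) (hdecay : CCSPE.Decays u)
    (Φ : CCSPE.JostEigenfunctions u) :
    -- the scattering matrix and the extensions `a`, `ā` of its blocks are well defined
    (Φ.IsScatteringMatrix Φ.scattering ∧
      CCSPE.IsUpperExtension (fun k => (Φ.scattering k).toBlocks₁₁) Φ.a ∧
      CCSPE.IsLowerExtension (fun k => (Φ.scattering k).toBlocks₂₂) Φ.abar) ∧
    ∀ kn : ℂ, 0 < kn.im → (Φ.a kn).det = 0 →
      -- the whole quartet consists of zeros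
      ((Φ.a (-star kn)).det = 0 ∧ (Φ.abar (star kn)).det = 0 ∧ (Φ.abar (-kn)).det = 0) ∧
      -- the rank characterization at `kn`, `kn*`
      (∀ x t : ℝ, List.TFAE [
        (Φ.P x t kn).rank = 2 ∧ (Φ.Pbar x t (star kn)).rank = 2,
        Φ.a kn = 0 ∧ Φ.abar (star kn) = 0,
        (Φ.A x t kn).rank = 0,
        (Φ.P x t kn).rank = 2,
        (Φ.Pbar x t (star kn)).rank = 2]) ∧
      -- the rank characterization at `-kn*`, `-kn`
      (∀ x t : ℝ, List.TFAE [
        (Φ.P x t (-star kn)).rank = 2 ∧ (Φ.Pbar x t (-kn)).rank = 2,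
        Φ.a (-star kn) = 0 ∧ Φ.abar (-kn) = 0,
        (Φ.A x t (-star kn)).rank = 0,
        (Φ.P x t (-star kn)).rank = 2,
        (Φ.Pbar x t (-kn)).rank = 2]) ∧
      -- equal ranks at the four eigenvalues of the quartet
      ((Φ.a kn).rank = (Φ.a (-star kn)).rank ∧
        (Φ.a kn).rank = (Φ.abar (star kn)).rank ∧
        (Φ.a kn).rank = (Φ.abar (-kn)).rank) := by
  refine ⟨⟨Φ.isScatteringMatrix_scattering hu hdecay, Φ.isUpperExtension_a hu hdecay,
    Φ.isLowerExtension_abar hu hdecay⟩, fun kn hk hdet => ?_⟩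
  -- The point `-k_n*` is again in the upper half plane and its conjugate is `-k_n`, so the results
  -- for `k_n` apply there verbatim.
  have hk' : 0 < (-star kn).im := by simpa using hk
  have hstar : star (-star kn) = -kn := by simp
  have h1 := Φ.rank_a_neg_star hu hdecay hk
  have h2 := Φ.rank_abar_star hu hdecay hk
  have h3 := Φ.rank_abar_star hu hdecay hk'
  rw [hstar] at h3
  have h4 := fun x t => Φ.tfae_rank hu hdecay hk' x t
  simp only [hstar] at h4
  simp only [CCSPE.det_eq_zero_iff_rank_lt] at hdet ⊢
  exact ⟨⟨by omega, by omega, by omega⟩, Φ.tfae_rank hu hdecay hk, h4, by omega, by omega, by omega⟩
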